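/- **Setting.** Differential-free terms $e$ are built from variables $x$, rational constants, $+$, $\cdot$ and finitely many function symbols $h_1,\dots,h_r$, each with a fixed arity $k$ and a fixed interpretation $h:\mathbb R^k\to\mathbb R$; together with each symbol and each $i\le k$ a term is given that serves as the syntactic partial derivative $\partial h/\partial y_i$. General terms may additionally contain differential variables $x'$ and differentials $(e)'$ of differential-free terms. The formulas of differential dynamic logic (dL) are built from comparisons ($=,\ge,>$) of terms by propositional connectives, quantifiers over variables and modalities $[\alpha],\langle\alpha\rangle$, where $\alpha$ is an assignment or an ODE system $x_1'=f_1,\dots,x_n'=f_n\,\&\,Q$ with distinct $x_i$ and differential-free right-hand sides (other variables are constant parameters). The domain $Q$ is a semianalytic formula, i.e. a propositional combination of comparisons of differential-free terms. The Lie derivatives of $e$ along $x'=f(x)$ are the terms $e^{(0)}=e$, $e^{(i+1)}=\sum_j \frac{\partial e^{(i)}}{\partial x_j} f_j$, where partial derivatives are taken syntactically. The *base calculus* is the classical sequent calculus for first-order logic with equality, with every substitution instance of a valid formula of first-order real arithmetic, the generalization rule G, the axioms K, V, duality $\langle\alpha\rangle P\leftrightarrow\neg[\alpha]\neg P$ and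 assignment, the axioms computing the differentials of constants, variables, sums, products and function applications, the basic ODE axioms * DE: $[x'=f\&Q]P\leftrightarrow[x'=f\&Q][x':=f]P$, * DW: $[x'=f\&Q]Q$, * DX: $[x'=f\&Q]P\leftrightarrow(Q\to P\wedge[x'=f\&Q]P)$, for $x'$ not free in $P$, * DMP: $[x'=f\&Q](Q\to R)\to([x'=f\&R]P\to[x'=f\&Q]P)$, * Barcan: $\langle x'=f\&Q\rangle\exists y\,P\leftrightarrow\exists y\,\langle x'=f\&Q\rangle P$, for $y$ not in the ODE, and * differential induction DI: $[x'=f\&Q](e)'=0\to([x'=f\&Q]e=0\leftrightarrow(Q\to e=0))$, and $[x'=f\&Q](e)'\ge0\to([x'=f\&Q]e\succcurlyeq0\leftrightarrow(Q\to e\succcurlyeq0))$ for $\succcurlyeq\,\in\{\ge,>\}$ (parameters $z$ occurring in $e$ must have differential $z'=0$), * differential cuts DC: $[x'=f\&Q]R\to([x'=f\&Q]P\leftrightarrow[x'=f\&Q\wedge R]P)$, * differential ghosts DG: $[x'=f\&Q]P\leftrightarrow\exists y\,[x'=f,\,y'=ay+b\,\&Q]P$, and the same with $\forall y$, for $y$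 fresh and $y$ not in $a,b$. The *extended calculus* adds * uniqueness Uniq: $\langle x'=f\&Q_1\wedge Q_2\rangle P\leftrightarrow\langle x'=f\&Q_1\rangle P\wedge\langle x'=f\&Q_2\rangle P$, * continuous existence Cont: $x=y\to(\langle x'=f\& e>0\rangle x\ne y\leftrightarrow e>0)$, for fresh $y$ and systems that provably have no fixpoint (i.e. $\neg\bigwedge_i f_i=0$ is provable). The *extended term conditions* are: (S) every $h_j$ is $C^\infty$; (P) the syntactic partial derivatives denote the partial derivatives of the $h_j$; (R) for every differential-free term $e$ and every system $x'=f(x)$ there are $N\ge1$ and terms $g_0,\dots,g_{N-1}$ such that the *differential radical identity* of rank $N$, $e^{(N)}=\sum_{i<N} g_i\,e^{(i)}$, is provable in the base calculus. **Theorem (Analytic completeness).** Assume that the term language satisfies the extended term conditions. Let $x'=f(x)$ be a system, $e$ a differential-free term, and $N\ge1$ and $g_0,\dots,g_{N-1}$ such that the differential radical identity of rank $N$ is provable in the base calculus. Then: 1. For every semianalytic formula $Q$, the base calculus derives $$\Big(Q\to\bigwedge_{i=0}^{N-1}e^{(i)}=0\Big)\;\to\;[x'=f(x)\,\&\,Q]\,e=0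 .$$ 2. For every $Q$ formed by conjunctions and disjunctions from strict inequalities ($s>t$ or $s\ne t$), the extended calculus derives $$[x'=f(x)\,\&\,Q]\,e=0\;\leftrightarrow\;\Big(Q\to\bigwedge_{i=0}^{N-1}e^{(i)}=0\Big).$$ -/

import Mathlib

open scoped ContDiff

/-! Terms, formulas and the proof calculus of the continuous fragment of differential dynamic
logic dL, over an extended term language with finitely many fixed function symbols. -/

namespace DL

/-- A finite list of fixed function symbols with their arities. -/
structure Sig where
  r : ℕ
  arity : Fin r → ℕ

/-- Terms over atoms `V`, built from atoms, rational constants, sums, products and applications of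
the fixed function symbols. -/
inductive Tm (S : Sig) (V : Type) : Type
  | atom (v : V) : Tm S V
  | const (c : ℚ) : Tm S V
  | add (s t : Tm S V) : Tm S V
  | mul (s t : Tm S V) : Tm S V
  | app (h : Fin S.r) (es : Fin (S.arity h) → Tm S V) : Tm S V

namespace Tm

variable {S : Sig} {V W : Type}

/-- Simultaneous replacement of atoms by terms. -/
def bind : Tm S V → (V → Tm S W) → Tm S W
  | atom v, σ => σ v
  | const c, _ => const c
  | add s t, σ => add (s.bind σ) (t.bind σ)
  | mul s t, σ => mul (s.bind σ) (t.bind σ)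
  | app h es, σ => app h (fun i => (es i).bind σ)

/-- The atoms that occur in a term. -/
def atoms : Tm S V → Set V
  | atom v => {v}
  | const _ => ∅
  | add s t => s.atoms ∪ t.atoms
  | mul s t => s.atoms ∪ t.atoms
  | app _ es => ⋃ i, (es i).atoms

def neg (t : Tm S V) : Tm S V := mul (const (-1)) t

def sub (s t : Tm S V) : Tm S V := add s t.neg

/-- The finite sum `f 0 + ... + f (n - 1)`. -/
def sum : (n : ℕ) → (Fin n → Tm S V) → Tm S V
  | 0, _ => const 0
  | n + 1, f => add (sum n (fun i => f i.castSucc)) (f (Fin.last n))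

/-- The real value of a term, for given meanings of the function symbols and of the atoms. -/
noncomputable def eval (I : (h : Fin S.r) → (Fin (S.arity h) → ℝ) → ℝ) (ρ : V → ℝ) :
    Tm S V → ℝ
  | atom v => ρ v
  | const c => (c : ℝ)
  | add s t => s.eval I ρ + t.eval I ρ
  | mul s t => s.eval I ρ * t.eval I ρ
  | app h es => I h (fun i => (es i).eval I ρ)

end Tm

/-- Variables: the base variables `x` and their differential variables `x'`. -/
inductive Var : Type
  | base (x : ℕ) : Var
  | prime (x : ℕ) : Var
  deriving DecidableEq

/-- Differential-free (extended) terms. -/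
abbrev DFTm (S : Sig) : Type := Tm S ℕ

/-- The atoms of general terms: variables, differential variables and differentials `(e)'` of
differential-free terms `e`. -/
inductive Atom (S : Sig) : Type
  | var (v : Var) : Atom S
  | diff (e : DFTm S) : Atom S

/-- General terms, which may mention differentials. -/
abbrev Term (S : Sig) : Type := Tm S (Atom S)

/-- A differential-free term, read as a general term. -/
def DFTm.toTerm {S : Sig} (e : DFTm S) : Term S := e.bind fun x => .atom (.var (.base x))

/-- The differential `(e)'`. -/
def DFTm.diff {S : Sig} (e : DFTm S) : Term S := .atom (.diff e)

/-- A variable, read as a term. -/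
def Var.toTerm {S : Sig} (v : Var) : Term S := .atom (.var v)

/-- Free variables of a differential-free term. -/
def DFTm.fv {S : Sig} (e : DFTm S) : Set Var := Var.base '' e.atoms

/-- Free variables of an atom; the differential `(e)'` depends on the variables of `e` and on
their differential variables. -/
def Atom.fv {S : Sig} : Atom S → Set Var
  | .var v => {v}
  | .diff e => Var.base '' e.atoms ∪ Var.prime '' e.atoms

def Term.fv {S : Sig} (t : Term S) : Set Var := ⋃ a ∈ t.atoms, a.fv

/-- Comparison operators. -/
inductive Cmp : Type
  | eq | ge | gt

def Cmp.holds : Cmp → ℝ → ℝ → Prop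
  | .eq, a, b => a = b
  | .ge, a, b => a ≥ b
  | .gt, a, b => a > b

/-- Semianalytic formulas: propositional combinations of comparisons of differential-free terms.
They serve as evolution domain constraints. -/
inductive Dom (S : Sig) : Type
  | cmp (c : Cmp) (s t : DFTm S) : Dom S
  | not (Q : Dom S) : Dom S
  | and (Q R : Dom S) : Dom S
  | or (Q R : Dom S) : Dom S

/-- The variables that occur in a semianalytic formula. -/
def Dom.vars {S : Sig} : Dom S → Set ℕ
  | .cmp _ s t => s.atoms ∪ t.atoms
  | .not Q => Q.vars
  | .and Q R => Q.vars ∪ R.vars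
  | .or Q R => Q.vars ∪ R.vars

/-- Formulas formed by conjunctions and disjunctions from strict inequalities `s > t` and
`s ≠ t`. -/
inductive Dom.Strict {S : Sig} : Dom S → Prop
  | gt (s t : DFTm S) : Dom.Strict (.cmp .gt s t)
  | ne (s t : DFTm S) : Dom.Strict (.not (.cmp .eq s t))
  | and {Q R : Dom S} : Dom.Strict Q → Dom.Strict R → Dom.Strict (.and Q R)
  | or {Q R : Dom S} : Dom.Strict Q → Dom.Strict R → Dom.Strict (.or Q R)

/-- A system `x₁' = f₁, ..., xₙ' = fₙ` of differential equations in explicit form. Variables that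
occur on a right-hand side without being among `x₁, ..., xₙ` are constant parameters. -/
structure ODE (S : Sig) where
  dim : ℕ
  vars : Fin dim → ℕ
  vars_inj : Function.Injective vars
  rhs : Fin dim → DFTm S

/-- Programs: `x' = f(x) & Q` and the assignment `v := t`. -/
inductive Prog (S : Sig) : Type
  | ode (o : ODE S) (Q : Dom S) : Prog S
  | assign (v : Var) (t : DFTm S) : Prog S

/-- Formulas of dL. -/
inductive Fml (S : Sig) : Type
  | cmp (c : Cmp) (s t : Term S) : Fml S
  | not (φ : Fml S) : Fml S
  | and (φ ψ : Fml S) : Fml S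
  | or (φ ψ : Fml S) : Fml S
  | all (v : Var) (φ : Fml S) : Fml S
  | ex (v : Var) (φ : Fml S) : Fml S
  | box (α : Prog S) (φ : Fml S) : Fml S
  | dia (α : Prog S) (φ : Fml S) : Fml S

namespace Fml

variable {S : Sig}

def imp (φ ψ : Fml S) : Fml S := or (not φ) ψ

def iff (φ ψ : Fml S) : Fml S := and (imp φ ψ) (imp ψ φ)

def eq (s t : Term S) : Fml S := cmp .eq s t

def tru : Fml S := eq (.const 0) (.const 0)

def fls : Fml S := eq (.const 0) (.const 1)

/-- The finite conjunction `F 0 ∧ ... ∧ F (n - 1)`. -/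
def bigAnd : (n : ℕ) → (Fin n → Fml S) → Fml S
  | 0, _ => tru
  | n + 1, F => and (bigAnd n (fun i => F i.castSucc)) (F (Fin.last n))

/-- The comparison of a differential-free term with `0`. -/
def cmpZero (c : Cmp) (e : DFTm S) : Fml S := cmp c e.toTerm (.const 0)

/-- The equation `e = 0`. -/
def eqZero (e : DFTm S) : Fml S := cmpZero .eq e

end Fml

/-- A semianalytic formula, read as a formula. -/
def Dom.toFml {S : Sig} : Dom S → Fml S
  | .cmp c s t => .cmp c s.toTerm t.toTerm
  | .not Q => .not Q.toFml
  | .and Q R => .and Q.toFml R.toFml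
  | .or Q R => .or Q.toFml R.toFml

/-! ### Free and bound variables -/

/-- The variables `x, x'` that a system changes. -/
def ODE.bound {S : Sig} (o : ODE S) : Set Var :=
  {v | ∃ i, v = .base (o.vars i) ∨ v = .prime (o.vars i)}

def Prog.bound {S : Sig} : Prog S → Set Var
  | .ode o _ => o.bound
  | .assign v _ => {v}

def Prog.fv {S : Sig} : Prog S → Set Var
  | .ode o Q => Set.range (fun i => Var.base (o.vars i)) ∪ (⋃ i, (o.rhs i).fv) ∪ Var.base '' Q.vars
  | .assign _ t => t.fv

def Fml.fv {S : Sig} : Fml S → Set Var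
  | .cmp _ s t => Term.fv s ∪ Term.fv t
  | .not φ => φ.fv
  | .and φ ψ => φ.fv ∪ ψ.fv
  | .or φ ψ => φ.fv ∪ ψ.fv
  | .all v φ => φ.fv \ {v}
  | .ex v φ => φ.fv \ {v}
  | .box α φ => α.fv ∪ (φ.fv \ α.bound)
  | .dia α φ => α.fv ∪ (φ.fv \ α.bound)

/-- The variable `y` is fresh for the system. -/
def ODE.Fresh {S : Sig} (o : ODE S) (y : ℕ) : Prop :=
  (∀ i, o.vars i ≠ y) ∧ ∀ i, y ∉ (o.rhs i).atoms

/-- The system `x' = f(x)` extended by the equation `y' = t`. -/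
def ODE.extend {S : Sig} (o : ODE S) (y : ℕ) (hy : o.Fresh y) (t : DFTm S) : ODE S where
  dim := o.dim + 1
  vars := Fin.snoc (α := fun _ => ℕ) o.vars y
  vars_inj := Fin.snoc_injective_of_injective o.vars_inj (by
    rintro ⟨i, hi⟩
    exact hy.1 i hi)
  rhs := Fin.snoc (α := fun _ => DFTm S) o.rhs t

/-- The iterated assignment `x₁' := f₁; ...; xₙ' := fₙ` in a box modality. Since the `fᵢ` are
differential-free, it agrees with the simultaneous assignment. -/
def ODE.boxAssign {S : Sig} (o : ODE S) (φ : Fml S) : Fml S :=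
  (List.finRange o.dim).foldr (fun i ψ => .box (.assign (.prime (o.vars i)) (o.rhs i)) ψ) φ

/-! ### Substitution of a differential-free term for a variable -/

def DFTm.subst {S : Sig} (v : Var) (e : DFTm S) (t : DFTm S) : DFTm S :=
  t.bind fun x => if v = .base x then e else .atom x

def Term.subst {S : Sig} (v : Var) (e : DFTm S) (t : Term S) : Term S :=
  t.bind fun a =>
    match a with
    | .var w => if v = w then e.toTerm else w.toTerm
    | .diff s => s.diff

def Dom.subst {S : Sig} (v : Var) (e : DFTm S) : Dom S → Dom S
  | .cmp c s t => .cmp c (DFTm.subst v e s) (DFTm.subst v e t)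
  | .not Q => .not (Q.subst v e)
  | .and Q R => .and (Q.subst v e) (R.subst v e)
  | .or Q R => .or (Q.subst v e) (R.subst v e)

def ODE.subst {S : Sig} (v : Var) (e : DFTm S) (o : ODE S) : ODE S where
  dim := o.dim
  vars := o.vars
  vars_inj := o.vars_inj
  rhs := fun i => DFTm.subst v e (o.rhs i)

/-- Substitution into the free occurrences of `v` in the terms of a program. -/
def Prog.subst {S : Sig} (v : Var) (e : DFTm S) : Prog S → Prog S
  | .ode o Q => .ode (o.subst v e) (Q.subst v e)
  | .assign w t => .assign w (DFTm.subst v e t)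

open Classical in
/-- The result `φ(e)` of replacing the free occurrences of `v` in `φ` by `e`; meaningful only if
`e` is free for `v` in `φ`. -/
noncomputable def Fml.subst {S : Sig} (v : Var) (e : DFTm S) : Fml S → Fml S
  | .cmp c s t => .cmp c (Term.subst v e s) (Term.subst v e t)
  | .not φ => .not (φ.subst v e)
  | .and φ ψ => .and (φ.subst v e) (ψ.subst v e)
  | .or φ ψ => .or (φ.subst v e) (ψ.subst v e)
  | .all w φ => if v = w then .all w φ else .all w (φ.subst v e)
  | .ex w φ => if v = w then .ex w φ else .ex w (φ.subst v e)
  | .box (.ode o Q) φ =>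
      if v ∈ o.bound then .box (.ode o Q) φ
      else .box (.ode (o.subst v e) (Q.subst v e)) (φ.subst v e)
  | .box (.assign w t) φ =>
      .box (.assign w (DFTm.subst v e t)) (if v = w then φ else φ.subst v e)
  | .dia (.ode o Q) φ =>
      if v ∈ o.bound then .dia (.ode o Q) φ
      else .dia (.ode (o.subst v e) (Q.subst v e)) (φ.subst v e)
  | .dia (.assign w t) φ =>
      .dia (.assign w (DFTm.subst v e t)) (if v = w then φ else φ.subst v e)

/-- No differential in `t` depends on `v`. -/
def Term.FreeFor {S : Sig} (v : Var) (t : Term S) : Prop :=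
  ∀ s : DFTm S, Atom.diff s ∈ t.atoms → v ∉ (Atom.diff s).fv

/-- The term `e` is free for `v` in the formula: no free occurrence of `v` lies inside a
differential or in the scope of a binder of `v` itself or of a variable of `e`. -/
def Fml.FreeFor {S : Sig} (v : Var) (e : DFTm S) : Fml S → Prop
  | .cmp _ s t => Term.FreeFor v s ∧ Term.FreeFor v t
  | .not φ => φ.FreeFor v e
  | .and φ ψ => φ.FreeFor v e ∧ ψ.FreeFor v e
  | .or φ ψ => φ.FreeFor v e ∧ ψ.FreeFor v e
  | .all w φ => v ∉ (Fml.all w φ).fv ∨ (w ∉ e.fv ∧ φ.FreeFor v e)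
  | .ex w φ => v ∉ (Fml.ex w φ).fv ∨ (w ∉ e.fv ∧ φ.FreeFor v e)
  | .box (.ode o Q) φ => v ∉ (Fml.box (.ode o Q) φ).fv ∨
      (v ∉ o.bound ∧ Disjoint e.fv o.bound ∧ φ.FreeFor v e)
  | .box (.assign w t) φ => v ∉ (Fml.box (.assign w t) φ).fv ∨
      (v = w ∨ (w ∉ e.fv ∧ φ.FreeFor v e))
  | .dia (.ode o Q) φ => v ∉ (Fml.dia (.ode o Q) φ).fv ∨
      (v ∉ o.bound ∧ Disjoint e.fv o.bound ∧ φ.FreeFor v e)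
  | .dia (.assign w t) φ => v ∉ (Fml.dia (.assign w t) φ).fv ∨
      (v = w ∨ (w ∉ e.fv ∧ φ.FreeFor v e))

/-! ### First-order real arithmetic and its substitution instances -/

/-- Polynomial terms over the variables of dL and over schematic variables from `W`. -/
inductive RTerm (W : Type) : Type
  | var (v : Var) : RTerm W
  | schem (w : W) : RTerm W
  | const (c : ℚ) : RTerm W
  | add (s t : RTerm W) : RTerm W
  | mul (s t : RTerm W) : RTerm W

/-- Formulas of first-order real arithmetic. -/
inductive RFml (W : Type) : Type
  | cmp (c : Cmp) (s t : RTerm W) : RFml W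
  | not (φ : RFml W) : RFml W
  | and (φ ψ : RFml W) : RFml W
  | or (φ ψ : RFml W) : RFml W
  | all (v : Var) (φ : RFml W) : RFml W
  | ex (v : Var) (φ : RFml W) : RFml W

namespace RTerm

variable {W : Type}

noncomputable def eval (ρ : Var → ℝ) (μ : W → ℝ) : RTerm W → ℝ
  | var v => ρ v
  | schem w => μ w
  | const c => (c : ℝ)
  | add s t => s.eval ρ μ + t.eval ρ μ
  | mul s t => s.eval ρ μ * t.eval ρ μ

def schems : RTerm W → Set W
  | var _ => ∅
  | schem w => {w}
  | const _ => ∅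
  | add s t => s.schems ∪ t.schems
  | mul s t => s.schems ∪ t.schems

def inst {S : Sig} (σ : W → Term S) : RTerm W → Term S
  | var v => v.toTerm
  | schem w => σ w
  | const c => .const c
  | add s t => .add (s.inst σ) (t.inst σ)
  | mul s t => .mul (s.inst σ) (t.inst σ)

end RTerm

namespace RFml

variable {W : Type}

def holds (ρ : Var → ℝ) (μ : W → ℝ) : RFml W → Prop
  | cmp c s t => c.holds (s.eval ρ μ) (t.eval ρ μ)
  | not φ => ¬ φ.holds ρ μ
  | and φ ψ => φ.holds ρ μ ∧ ψ.holds ρ μ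
  | or φ ψ => φ.holds ρ μ ∨ ψ.holds ρ μ
  | all v φ => ∀ a : ℝ, φ.holds (Function.update ρ v a) μ
  | ex v φ => ∃ a : ℝ, φ.holds (Function.update ρ v a) μ

/-- Validity over the real numbers. -/
def Valid (φ : RFml W) : Prop := ∀ (ρ : Var → ℝ) (μ : W → ℝ), φ.holds ρ μ

def schems : RFml W → Set W
  | cmp _ s t => s.schems ∪ t.schems
  | not φ => φ.schems
  | and φ ψ => φ.schems ∪ ψ.schems
  | or φ ψ => φ.schems ∪ ψ.schems
  | all _ φ => φ.schems
  | ex _ φ => φ.schems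

/-- The instance of an arithmetic formula under a substitution of terms for schematic variables. -/
def inst {S : Sig} (σ : W → Term S) : RFml W → Fml S
  | cmp c s t => .cmp c (s.inst σ) (t.inst σ)
  | not φ => .not (φ.inst σ)
  | and φ ψ => .and (φ.inst σ) (ψ.inst σ)
  | or φ ψ => .or (φ.inst σ) (ψ.inst σ)
  | all v φ => .all v (φ.inst σ)
  | ex v φ => .ex v (φ.inst σ)

/-- No variable of a substituted term is captured by a quantifier. -/
def Admissible {S : Sig} (σ : W → Term S) : RFml W → Prop
  | cmp _ _ _ => True
  | not φ => φ.Admissible σ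
  | and φ ψ => φ.Admissible σ ∧ ψ.Admissible σ
  | or φ ψ => φ.Admissible σ ∧ ψ.Admissible σ
  | all v φ => (∀ w ∈ φ.schems, v ∉ Term.fv (σ w)) ∧ φ.Admissible σ
  | ex v φ => (∀ w ∈ φ.schems, v ∉ Term.fv (σ w)) ∧ φ.Admissible σ

end RFml

/-! ### Extended term languages and Lie derivatives -/

/-- An extended term language: function symbols with fixed real interpretations, and, for each
symbol `h` of arity `k` and each `i`, a term in `y₁, ..., yₖ` intended to represent the partial
derivative of `h` by its `i`-th argument. -/
structure TermLang where
  sig : Sig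
  interp : (h : Fin sig.r) → (Fin (sig.arity h) → ℝ) → ℝ
  partialTerm : (h : Fin sig.r) → Fin (sig.arity h) → Tm sig (Fin (sig.arity h))

namespace TermLang

variable (L : TermLang)

/-- The syntactic partial derivative of a term by the variable `x`. -/
def pderiv (x : ℕ) : DFTm L.sig → DFTm L.sig
  | .atom y => if y = x then .const 1 else .const 0
  | .const _ => .const 0
  | .add s t => .add (pderiv x s) (pderiv x t)
  | .mul s t => .add (.mul (pderiv x s) t) (.mul s (pderiv x t))
  | .app h es =>
      .sum _ (fun i => .mul ((L.partialTerm h i).bind es) (pderiv x (es i)))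

/-- The Lie derivative of `e` along the system: the sum of the `∂e/∂xᵢ · fᵢ`. -/
def lie (o : ODE L.sig) (e : DFTm L.sig) : DFTm L.sig :=
  .sum o.dim (fun i => .mul (L.pderiv (o.vars i) e) (o.rhs i))

/-- Higher Lie derivatives. -/
def lieN (o : ODE L.sig) (e : DFTm L.sig) : ℕ → DFTm L.sig
  | 0 => e
  | i + 1 => L.lie o (lieN o e i)

/-- The differential radical formula of rank `N`: all Lie derivatives of `e` of order
`0, ..., N - 1` vanish. -/
def diffRadicalFml (o : ODE L.sig) (e : DFTm L.sig) (N : ℕ) : Fml L.sig :=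
  .bigAnd N (fun i => .eqZero (L.lieN o e i))

end TermLang

/-! ### The proof calculus -/

/-- The base calculus of dL, whose axioms about differential equations proper are DI, DC and DG, and
its extension by the existence and uniqueness axioms Cont and Uniq. -/
inductive Calculus : Type
  | base | extended

/-- The vectorial equation `x = y`, for the variables `x` of a system. -/
def ODE.vecEq {S : Sig} (o : ODE S) (y : Fin o.dim → ℕ) : Fml S :=
  .bigAnd o.dim (fun i => .eq (Var.base (o.vars i)).toTerm (Var.base (y i)).toTerm)

/-- The variable `x` occurs in `e` and is not changed by the system. Differential induction for `e`
treats such a parameter as a constant, so it requires its differential `x'` to be `0`; if all the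
variables of `e` are among the `xᵢ`, then nothing is required. -/
def ODE.ConstOutside {S : Sig} (o : ODE S) (e : DFTm S) (x : ℕ) : Prop :=
  x ∈ e.atoms ∧ ∀ i, o.vars i ≠ x

/-- `Derivable L k Γ φ`: the sequent `Γ ⊢ φ` is provable. -/
inductive Derivable (L : TermLang) (k : Calculus) : List (Fml L.sig) → Fml L.sig → Prop
  -- structural and propositional rules
  | ax {Γ φ} : φ ∈ Γ → Derivable L k Γ φ
  | weaken {Γ Δ φ} : Γ ⊆ Δ → Derivable L k Γ φ → Derivable L k Δ φ
  | cut {Γ φ ψ} : Derivable L k Γ ψ → Derivable L k (ψ :: Γ) φ → Derivable L k Γ φ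
  | notL {Γ φ} : Derivable L k Γ φ → Derivable L k (.not φ :: Γ) .fls
  | notR {Γ φ} : Derivable L k (φ :: Γ) .fls → Derivable L k Γ (.not φ)
  | byContra {Γ φ} : Derivable L k (.not φ :: Γ) .fls → Derivable L k Γ φ
  | andL {Γ φ₁ φ₂ ψ} : Derivable L k (φ₁ :: φ₂ :: Γ) ψ → Derivable L k (.and φ₁ φ₂ :: Γ) ψ
  | andR {Γ φ₁ φ₂} : Derivable L k Γ φ₁ → Derivable L k Γ φ₂ → Derivable L k Γ (.and φ₁ φ₂)
  | orL {Γ φ₁ φ₂ ψ} : Derivable L k (φ₁ :: Γ) ψ → Derivable L k (φ₂ :: Γ) ψ →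
      Derivable L k (.or φ₁ φ₂ :: Γ) ψ
  | orR₁ {Γ φ₁ φ₂} : Derivable L k Γ φ₁ → Derivable L k Γ (.or φ₁ φ₂)
  | orR₂ {Γ φ₁ φ₂} : Derivable L k Γ φ₂ → Derivable L k Γ (.or φ₁ φ₂)
  | impL {Γ φ₁ φ₂ ψ} : Derivable L k Γ φ₁ → Derivable L k (φ₂ :: Γ) ψ →
      Derivable L k (.imp φ₁ φ₂ :: Γ) ψ
  | impR {Γ φ₁ φ₂} : Derivable L k (φ₁ :: Γ) φ₂ → Derivable L k Γ (.imp φ₁ φ₂)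
  -- quantifier rules; a quantifier may be instantiated with its own variable or with a term
  | allL {Γ v φ ψ} : Derivable L k (φ :: Γ) ψ → Derivable L k (.all v φ :: Γ) ψ
  | allLInst {Γ} {v : Var} {φ ψ : Fml L.sig} (e : DFTm L.sig) : φ.FreeFor v e →
      Derivable L k (φ.subst v e :: Γ) ψ → Derivable L k (.all v φ :: Γ) ψ
  | allR {Γ v φ} : (∀ χ ∈ Γ, v ∉ χ.fv) → Derivable L k Γ φ → Derivable L k Γ (.all v φ)
  | exL {Γ v φ ψ} : (∀ χ ∈ Γ, v ∉ χ.fv) → v ∉ ψ.fv →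
      Derivable L k (φ :: Γ) ψ → Derivable L k (.ex v φ :: Γ) ψ
  | exR {Γ v φ} : Derivable L k Γ φ → Derivable L k Γ (.ex v φ)
  | exRInst {Γ} {v : Var} {φ : Fml L.sig} (e : DFTm L.sig) : φ.FreeFor v e →
      Derivable L k Γ (φ.subst v e) → Derivable L k Γ (.ex v φ)
  -- replacement of equals, and real arithmetic
  | eqSubst {Γ} {v : Var} {φ : Fml L.sig} (s t : DFTm L.sig) : φ.FreeFor v s → φ.FreeFor v t →
      Derivable L k Γ (.eq s.toTerm t.toTerm) → Derivable L k Γ (φ.subst v s) →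
      Derivable L k Γ (φ.subst v t)
  | real {Γ} {W : Type} (ψ : RFml W) (σ : W → Term L.sig) : ψ.Valid → ψ.Admissible σ →
      Derivable L k Γ (ψ.inst σ)
  -- axioms and rules for all programs
  | G {Γ φ} (α : Prog L.sig) : Derivable L k [] φ → Derivable L k Γ (.box α φ)
  | K {Γ} (α : Prog L.sig) (φ ψ) :
      Derivable L k Γ (.imp (.box α (.imp φ ψ)) (.imp (.box α φ) (.box α ψ)))
  | V {Γ} (α : Prog L.sig) (φ) : Disjoint φ.fv α.bound → Derivable L k Γ (.imp φ (.box α φ))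
  | diamond {Γ} (α : Prog L.sig) (φ) :
      Derivable L k Γ (.iff (.dia α φ) (.not (.box α (.not φ))))
  | assign {Γ} (v : Var) (e : DFTm L.sig) (φ : Fml L.sig) : φ.FreeFor v e →
      Derivable L k Γ (.iff (.box (.assign v e) φ) (φ.subst v e))
  -- differential axioms
  | diffConst {Γ} (c : ℚ) :
      Derivable L k Γ (.eq (DFTm.diff (.const c)) (.const 0))
  | diffVar {Γ} (x : ℕ) :
      Derivable L k Γ (.eq (DFTm.diff (.atom x)) (Var.prime x).toTerm)
  | diffAdd {Γ} (s t : DFTm L.sig) :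
      Derivable L k Γ (.eq (DFTm.diff (.add s t)) (.add s.diff t.diff))
  | diffMul {Γ} (s t : DFTm L.sig) :
      Derivable L k Γ (.eq (DFTm.diff (.mul s t))
        (.add (.mul s.diff t.toTerm) (.mul s.toTerm t.diff)))
  | diffApp {Γ} (h : Fin L.sig.r) (es : Fin (L.sig.arity h) → DFTm L.sig) :
      Derivable L k Γ (.eq (DFTm.diff (.app h es))
        (.sum _ (fun i => .mul (DFTm.toTerm ((L.partialTerm h i).bind es)) (es i).diff)))
  -- basic axioms for differential equations
  | DE {Γ} (o : ODE L.sig) (Q : Dom L.sig) (φ) :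
      Derivable L k Γ (.iff (.box (.ode o Q) φ) (.box (.ode o Q) (o.boxAssign φ)))
  | DW {Γ} (o : ODE L.sig) (Q : Dom L.sig) : Derivable L k Γ (.box (.ode o Q) Q.toFml)
  | DX {Γ} (o : ODE L.sig) (Q : Dom L.sig) (φ) : (∀ i, Var.prime (o.vars i) ∉ φ.fv) →
      Derivable L k Γ
        (.iff (.box (.ode o Q) φ) (.imp Q.toFml (.and φ (.box (.ode o Q) φ))))
  | DMP {Γ} (o : ODE L.sig) (Q R : Dom L.sig) (φ) :
      Derivable L k Γ (.imp (.box (.ode o Q) (.imp Q.toFml R.toFml))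
        (.imp (.box (.ode o R) φ) (.box (.ode o Q) φ)))
  | barcan {Γ} (o : ODE L.sig) (Q : Dom L.sig) (v : Var) (φ) :
      v ∉ (Prog.ode o Q).fv → v ∉ o.bound →
      Derivable L k Γ
        (.iff (.dia (.ode o Q) (.ex v φ)) (.ex v (.dia (.ode o Q) φ)))
  -- differential invariants, differential cuts and differential ghosts
  | DIeq {Γ} (o : ODE L.sig) (Q : Dom L.sig) (e : DFTm L.sig) :
      (∀ x, o.ConstOutside e x → Derivable L k Γ (.eq (Var.prime x).toTerm (.const 0))) →
      Derivable L k Γ (.imp (.box (.ode o Q) (.eq e.diff (.const 0)))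
        (.iff (.box (.ode o Q) (.eqZero e)) (.imp Q.toFml (.eqZero e))))
  | DIge {Γ} (o : ODE L.sig) (Q : Dom L.sig) (e : DFTm L.sig) :
      (∀ x, o.ConstOutside e x → Derivable L k Γ (.eq (Var.prime x).toTerm (.const 0))) →
      Derivable L k Γ (.imp (.box (.ode o Q) (.cmp .ge e.diff (.const 0)))
        (.iff (.box (.ode o Q) (.cmpZero .ge e)) (.imp Q.toFml (.cmpZero .ge e))))
  | DIgt {Γ} (o : ODE L.sig) (Q : Dom L.sig) (e : DFTm L.sig) :
      (∀ x, o.ConstOutside e x → Derivable L k Γ (.eq (Var.prime x).toTerm (.const 0))) →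
      Derivable L k Γ (.imp (.box (.ode o Q) (.cmp .ge e.diff (.const 0)))
        (.iff (.box (.ode o Q) (.cmpZero .gt e)) (.imp Q.toFml (.cmpZero .gt e))))
  | DC {Γ} (o : ODE L.sig) (Q R : Dom L.sig) (φ) :
      Derivable L k Γ (.imp (.box (.ode o Q) R.toFml)
        (.iff (.box (.ode o Q) φ) (.box (.ode o (.and Q R)) φ)))
  | DG {Γ} (o : ODE L.sig) (Q : Dom L.sig) (φ) (y : ℕ) (a b : DFTm L.sig) (hy : o.Fresh y) :
      y ∉ Q.vars → y ∉ a.atoms → y ∉ b.atoms → Var.base y ∉ φ.fv → Var.prime y ∉ φ.fv →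
      Derivable L k Γ (.iff (.box (.ode o Q) φ)
        (.ex (.base y) (.box (.ode (o.extend y hy (.add (.mul a (.atom y)) b)) Q) φ)))
  | DGall {Γ} (o : ODE L.sig) (Q : Dom L.sig) (φ) (y : ℕ) (a b : DFTm L.sig) (hy : o.Fresh y) :
      y ∉ Q.vars → y ∉ a.atoms → y ∉ b.atoms → Var.base y ∉ φ.fv → Var.prime y ∉ φ.fv →
      Derivable L k Γ (.iff (.box (.ode o Q) φ)
        (.all (.base y) (.box (.ode (o.extend y hy (.add (.mul a (.atom y)) b)) Q) φ)))
  -- existence and uniqueness, in the extended calculus only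
  | Uniq {Γ} (hk : k = .extended) (o : ODE L.sig) (Q₁ Q₂ : Dom L.sig) (φ) :
      Derivable L k Γ (.iff (.dia (.ode o (.and Q₁ Q₂)) φ)
        (.and (.dia (.ode o Q₁) φ) (.dia (.ode o Q₂) φ)))
  -- the first premise of Cont says that the system has no fixpoint
  | Cont {Γ} (hk : k = .extended) (o : ODE L.sig) (e : DFTm L.sig) (y : Fin o.dim → ℕ) :
      Derivable L k [] (.not (.bigAnd o.dim (fun i => .eqZero (o.rhs i)))) →
      Function.Injective y → (∀ i, o.Fresh (y i)) → (∀ i, y i ∉ e.atoms) →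
      Derivable L k Γ (.imp (o.vecEq y)
        (.iff (.dia (.ode o (.cmp .gt e (.const 0))) (.not (o.vecEq y))) (.cmpZero .gt e)))

/-! ### The extended term conditions -/

/-- The differential radical identity of rank `N ≥ 1` with cofactors `g` is provable for `e` along
the system: the `N`-th Lie derivative of `e` is `∑ i < N, gᵢ` times the `i`-th one. -/
def TermLang.DiffRadical (L : TermLang) (o : ODE L.sig) (e : DFTm L.sig) (N : ℕ)
    (g : Fin N → DFTm L.sig) : Prop :=
  1 ≤ N ∧ Derivable L .base []
    (.eq (L.lieN o e N).toTerm
      (DFTm.toTerm (.sum N (fun i => .mul (g i) (L.lieN o e i)))))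

/-- The extended term conditions. -/
structure TermLang.ExtendedTermConditions (L : TermLang) : Prop where
  /-- Smoothness. -/
  smooth : ∀ h, ContDiff ℝ ∞ (L.interp h)
  /-- Syntactic partial derivatives. -/
  partials : ∀ (h : Fin L.sig.r) (i : Fin (L.sig.arity h)) (y : Fin (L.sig.arity h) → ℝ),
    (L.partialTerm h i).eval L.interp y = fderiv ℝ (L.interp h) y (Pi.single i 1)
  /-- Differential radicals. -/
  radicals : ∀ (o : ODE L.sig) (e : DFTm L.sig), ∃ (N : ℕ) (g : Fin N → DFTm L.sig),
    L.DiffRadical o e N g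

end DL

/-! Sufficiency. Put `p i = e^(i)` and `v = ∑ i < N, (p i)²`. In `v' = ∑ 2 p_i p_(i+1)` the only
term outside the list is `p_N`, and the radical identity expresses it through the list, so
elementary estimates give `v' ≤ (3 + ∑ g_i²) v` (`sum_chain_le`). A Grönwall argument then keeps `v
≤ 0`, hence `e = 0`. In the calculus it is carried out with differential ghosts (`darboux_le`): for
`y' = -h y` the quantity `-v y²` is nondecreasing whenever `v' ≤ 2 h v`, and a second ghost `z' = h
z` with invariant `y z = 1` certifies `y ≠ 0`.

Necessity. Suppose `e = 0` along the flow in a strict domain `Q` that holds initially. A ghost clock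
with slope 1 removes all fixpoints. If `p 0, ..., p (n-1)` vanish initially and `p n > 0`, pick a
constant `ε > 0` below `p n` and with `ε (1 + ∑ f_i²) < 1`, and add both strict bounds to the
domain. By Cont and Uniq the flow can still leave its initial state there (`dia_strict`). Repeated
differential induction gives `e ≥ ε t^n / n!` for the elapsed time `t` (`box_growth`), so `e = 0`
forces `t = 0`. The speed bound gives `ε |x_i - y_i| ≤ t` for the initial values `y_i`
(`box_speed`), so no coordinate has moved, a contradiction (`fls_of_pos`). The same argument for
`-e` excludes `p n < 0`, and induction on `n` gives the radical formula (`diffRadical_of_box`).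

The routine reasoning in between is delegated to `entail`: any quantifier-free consequence that
holds in all real valuations respecting constants, sums and products is derivable, with modal
formulas treated as propositional atoms. This allows Lie derivatives to be compared by value,
although the syntactic terms differ. -/

namespace DL

/-! ### Propositional and algebraic consequence -/

section Consequence

variable {S : Sig}

/-- Real valuations of terms that respect constants, sums and products. -/
structure IsAlg {V : Type} (M : Tm S V → ℝ) : Prop where
  const : ∀ c : ℚ, M (.const c) = c
  add : ∀ s t, M (.add s t) = M s + M t
  mul : ∀ s t, M (.mul s t) = M s * M t

/-- Truth of a formula when terms are valued by `M`, and quantified and modal formulas are treated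
as propositional atoms valued by `B`. -/
def Fml.Sat (M : Term S → ℝ) (B : Fml S → Prop) : Fml S → Prop
  | .cmp c s t => c.holds (M s) (M t)
  | .not φ => ¬ φ.Sat M B
  | .and φ ψ => φ.Sat M B ∧ ψ.Sat M B
  | .or φ ψ => φ.Sat M B ∨ ψ.Sat M B
  | .all v φ => B (.all v φ)
  | .ex v φ => B (.ex v φ)
  | .box α φ => B (.box α φ)
  | .dia α φ => B (.dia α φ)

/-- The maximal quantified or modal subformulas. -/
def Fml.mods : Fml S → List (Fml S)
  | .cmp _ _ _ => []
  | .not φ => φ.mods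
  | .and φ ψ => φ.mods ++ ψ.mods
  | .or φ ψ => φ.mods ++ ψ.mods
  | .all v φ => [.all v φ]
  | .ex v φ => [.ex v φ]
  | .box α φ => [.box α φ]
  | .dia α φ => [.dia α φ]

/-- The polynomial skeleton of a term. -/
def Term.skeleton : Term S → RTerm (Term S)
  | .atom v => .schem (.atom v)
  | .const c => .const c
  | .add s t => .add (skeleton s) (skeleton t)
  | .mul s t => .mul (skeleton s) (skeleton t)
  | .app h es => .schem (.app h es)

theorem Term.skeleton_inst (t : Term S) : t.skeleton.inst id = t := by
  induction t <;> simp_all [skeleton, RTerm.inst]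

/-- The truth constants of real arithmetic. -/
def RFml.ofBool (W : Type) (b : Bool) : RFml W :=
  .cmp .eq (.const 0) (.const (if b then 0 else 1))

theorem RFml.ofBool_holds {W : Type} (ρ : Var → ℝ) (μ : W → ℝ) (b : Bool) :
    (RFml.ofBool W b).holds ρ μ ↔ b = true := by
  cases b <;> simp [ofBool, holds, Cmp.holds, RTerm.eval]

open Classical in
/-- The arithmetic formula that arises by evaluating quantified and modal subformulas by `B`. -/
noncomputable def Fml.skeleton (B : Fml S → Prop) : Fml S → RFml (Term S)
  | .cmp c s t => .cmp c (Term.skeleton s) (Term.skeleton t)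
  | .not φ => .not (φ.skeleton B)
  | .and φ ψ => .and (φ.skeleton B) (ψ.skeleton B)
  | .or φ ψ => .or (φ.skeleton B) (ψ.skeleton B)
  | .all v φ => .ofBool _ (decide (B (.all v φ)))
  | .ex v φ => .ofBool _ (decide (B (.ex v φ)))
  | .box α φ => .ofBool _ (decide (B (.box α φ)))
  | .dia α φ => .ofBool _ (decide (B (.dia α φ)))

theorem Fml.skeleton_admissible (B : Fml S → Prop) (φ : Fml S) :
    (φ.skeleton B).Admissible (id : Term S → Term S) := by
  induction φ <;> simp_all [skeleton, RFml.Admissible, RFml.ofBool]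

theorem Fml.skeleton_holds (B : Fml S → Prop) (ρ : Var → ℝ) (μ : Term S → ℝ) (φ : Fml S) :
    (φ.skeleton B).holds ρ μ ↔ φ.Sat (fun t => t.skeleton.eval ρ μ) B := by
  induction φ <;> simp_all [skeleton, RFml.holds, RFml.ofBool_holds, Sat]

theorem Term.skeleton_isAlg (ρ : Var → ℝ) (μ : Term S → ℝ) :
    IsAlg (fun t : Term S => t.skeleton.eval ρ μ) :=
  ⟨fun _ => rfl, fun _ _ => rfl, fun _ _ => rfl⟩

end Consequence

namespace Derivable

variable {L : TermLang} {k : Calculus} {Γ Δ : List (Fml L.sig)} {φ ψ χ : Fml L.sig}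

theorem mp (h : Derivable L k Γ (.imp φ ψ)) (h' : Derivable L k Γ φ) : Derivable L k Γ ψ :=
  cut h (impL h' (ax (by simp)))

theorem exfalso (h : Derivable L k Γ .fls) : Derivable L k Γ φ :=
  byContra (weaken (by simp) h)

theorem ofNil (h : Derivable L k [] φ) : Derivable L k Γ φ := weaken (by simp) h

/-- Cut with all premises at once. -/
theorem of_premises (h : Derivable L k Δ φ) (hΔ : ∀ ψ ∈ Δ, Derivable L k Γ ψ) :
    Derivable L k Γ φ := by
  induction Δ generalizing φ with
  | nil => exact ofNil h
  | cons ψ Δ ih => exact mp (ih (impR h) fun χ hχ => hΔ χ (by simp [hχ])) (hΔ ψ (by simp))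

theorem ofBool_true : Derivable L k Γ ((RFml.ofBool Unit true).inst fun _ => .const 0) :=
  real _ _ (fun ρ μ => (RFml.ofBool_holds ρ μ true).2 rfl) trivial

-- Base case of `skeleton_equiv`: once the context decides a quantified or modal formula, that
-- formula is interchangeable with a truth constant, so no arithmetic substitution ever has to enter
-- it.
open Classical in
theorem skeleton_atom {B : Fml L.sig → Prop} (h₁ : B φ → Derivable L k Γ φ)
    (h₂ : ¬ B φ → Derivable L k Γ (.not φ)) :
    Derivable L k (φ :: Γ) ((RFml.ofBool (Term L.sig) (decide (B φ))).inst id) ∧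
    Derivable L k ((RFml.ofBool (Term L.sig) (decide (B φ))).inst id :: Γ) φ := by
  by_cases hB : B φ
  · simp only [hB, decide_true]
    exact ⟨ofBool_true, weaken (by simp) (h₁ hB)⟩
  · simp only [hB, decide_false]
    refine ⟨cut (weaken (List.subset_cons_self _ _) (h₂ hB)) (notL (ax (by simp))),
      exfalso (ax ?_)⟩
    simp [RFml.ofBool, RFml.inst, RTerm.inst, Fml.fls, Fml.eq]

/-- A formula is equivalent to its skeleton if the context decides its atoms as `B` does. -/
theorem skeleton_equiv (B : Fml L.sig → Prop) (φ : Fml L.sig) (Γ : List (Fml L.sig))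
    (h₁ : ∀ χ ∈ φ.mods, B χ → Derivable L k Γ χ)
    (h₂ : ∀ χ ∈ φ.mods, ¬ B χ → Derivable L k Γ (.not χ)) :
    Derivable L k (φ :: Γ) ((φ.skeleton B).inst id) ∧
    Derivable L k ((φ.skeleton B).inst id :: Γ) φ := by
  induction φ with
  | cmp c s t =>
    simp only [Fml.skeleton, RFml.inst, Term.skeleton_inst]
    exact ⟨ax (by simp), ax (by simp)⟩
  | not φ ih =>
    obtain ⟨a, b⟩ := ih h₁ h₂
    simp only [Fml.skeleton, RFml.inst]
    constructor
    · refine notR (weaken ?_ (notL b))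
      intro x; simp; tauto
    · refine notR (weaken ?_ (notL a))
      intro x; simp; tauto
  | and φ ψ ih₁ ih₂ =>
    obtain ⟨a₁, b₁⟩ := ih₁ (fun χ hχ => h₁ χ (by simp [Fml.mods, hχ]))
      (fun χ hχ => h₂ χ (by simp [Fml.mods, hχ]))
    obtain ⟨a₂, b₂⟩ := ih₂ (fun χ hχ => h₁ χ (by simp [Fml.mods, hχ]))
      (fun χ hχ => h₂ χ (by simp [Fml.mods, hχ]))
    simp only [Fml.skeleton, RFml.inst]
    constructor
    · refine andL (andR (weaken ?_ a₁) (weaken ?_ a₂)) <;> (intro x; simp; tauto)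
    · refine andL (andR (weaken ?_ b₁) (weaken ?_ b₂)) <;> (intro x; simp; tauto)
  | or φ ψ ih₁ ih₂ =>
    obtain ⟨a₁, b₁⟩ := ih₁ (fun χ hχ => h₁ χ (by simp [Fml.mods, hχ]))
      (fun χ hχ => h₂ χ (by simp [Fml.mods, hχ]))
    obtain ⟨a₂, b₂⟩ := ih₂ (fun χ hχ => h₁ χ (by simp [Fml.mods, hχ]))
      (fun χ hχ => h₂ χ (by simp [Fml.mods, hχ]))
    simp only [Fml.skeleton, RFml.inst]
    exact ⟨orL (orR₁ a₁) (orR₂ a₂), orL (orR₁ b₁) (orR₂ b₂)⟩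
  | all v φ => exact skeleton_atom (h₁ _ (by simp [Fml.mods])) (h₂ _ (by simp [Fml.mods]))
  | ex v φ => exact skeleton_atom (h₁ _ (by simp [Fml.mods])) (h₂ _ (by simp [Fml.mods]))
  | box v φ => exact skeleton_atom (h₁ _ (by simp [Fml.mods])) (h₂ _ (by simp [Fml.mods]))
  | dia v φ => exact skeleton_atom (h₁ _ (by simp [Fml.mods])) (h₂ _ (by simp [Fml.mods]))

theorem em_cases (ψ : Fml L.sig) (h₁ : Derivable L k (ψ :: Γ) φ)
    (h₂ : Derivable L k (.not ψ :: Γ) φ) : Derivable L k Γ φ := by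
  have em : Derivable L k Γ (.or (.not ψ) ψ) := impR (ax (by simp))
  exact cut em (orL h₂ h₁)

-- Excluded middle for every formula of the list; each truth assignment `B` is one branch of the
-- case distinction.
open Classical in
theorem decide_cases (l : List (Fml L.sig))
    (h : ∀ B : Fml L.sig → Prop,
      Derivable L k (l.map (fun χ => if B χ then χ else .not χ) ++ Γ) φ) :
    Derivable L k Γ φ := by
  induction l with
  | nil => exact h (fun _ => True)
  | cons χ l ih =>
    refine ih fun B => ?_
    by_cases hχ : χ ∈ l
    -- A repeated formula has already been decided by `B`; splitting on it again could contradict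
    -- that choice.
    · refine weaken ?_ (h B)
      intro x hx
      simp only [List.map_cons, List.cons_append, List.mem_cons, List.mem_append,
        List.mem_map] at hx ⊢
      rcases hx with rfl | hx
      · exact Or.inl ⟨χ, hχ, rfl⟩
      · exact hx
    · have key : ∀ b : Prop, l.map (fun ξ => if Function.update B χ b ξ then ξ else .not ξ) =
          l.map (fun ξ => if B ξ then ξ else .not ξ) := by
        intro b
        refine List.map_congr_left fun ξ hξ => ?_
        rw [Function.update_of_ne (by rintro rfl; exact hχ hξ)]
      refine em_cases χ ?_ ?_
      · simpa [key] using h (Function.update B χ True)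
      · simpa [key] using h (Function.update B χ False)

/-- In each branch that decides the modal atoms, the skeleton is a quantifier-free arithmetic
formula whose schematic variables stand for the non-polynomial subterms. Every valuation of these
variables induces an `IsAlg` valuation of terms, so the hypothesis makes the skeleton valid and
`real` applies. -/
theorem entail_nil (h : ∀ M B, IsAlg M → φ.Sat M B) : Derivable L k Γ φ := by
  classical
  refine decide_cases φ.mods fun B => ?_
  refine cut (real (φ.skeleton B) id (fun ρ μ => ?_) (Fml.skeleton_admissible B φ))
    (skeleton_equiv B φ _ ?_ ?_).2
  · exact (Fml.skeleton_holds B ρ μ φ).2 (h _ _ (Term.skeleton_isAlg ρ μ))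
  all_goals
    intro χ hχ hB
    refine ax (List.mem_append_left _ (List.mem_map.2 ⟨χ, hχ, by simp [hB]⟩))

/-- Consequences by propositional logic and quantifier-free real arithmetic are derivable. -/
theorem entail (Δ : List (Fml L.sig)) (hΔ : ∀ ψ ∈ Δ, Derivable L k Γ ψ)
    (h : ∀ M B, IsAlg M → (∀ ψ ∈ Δ, ψ.Sat M B) → φ.Sat M B) : Derivable L k Γ φ := by
  induction Δ generalizing φ with
  | nil => exact entail_nil fun M B hM => h M B hM (by simp)
  | cons ψ Δ ih =>
    refine mp (ih (fun ψ hψ => hΔ ψ (by simp [hψ])) fun M B hM hs => ?_) (hΔ ψ (by simp))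
    by_cases hψ : ψ.Sat M B
    · exact Or.inr (h M B hM (by simpa [hψ] using hs))
    · exact Or.inl hψ

theorem entail_ax (h : ∀ M B, IsAlg M → (∀ ψ ∈ Γ, ψ.Sat M B) → φ.Sat M B) : Derivable L k Γ φ :=
  entail Γ (fun _ hψ => ax hψ) h

theorem toExtended (h : Derivable L .base Γ φ) : Derivable L k Γ φ := by
  cases k
  · exact h
  induction h with
  | ax h => exact ax h
  | weaken h _ ih => exact weaken h ih
  | cut _ _ ih₁ ih₂ => exact cut ih₁ ih₂
  | notL _ ih => exact notL ih
  | notR _ ih => exact notR ih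
  | byContra _ ih => exact byContra ih
  | andL _ ih => exact andL ih
  | andR _ _ ih₁ ih₂ => exact andR ih₁ ih₂
  | orL _ _ ih₁ ih₂ => exact orL ih₁ ih₂
  | orR₁ _ ih => exact orR₁ ih
  | orR₂ _ ih => exact orR₂ ih
  | impL _ _ ih₁ ih₂ => exact impL ih₁ ih₂
  | impR _ ih => exact impR ih
  | allL _ ih => exact allL ih
  | allLInst e he _ ih => exact allLInst e he ih
  | allR h _ ih => exact allR h ih
  | exL h h' _ ih => exact exL h h' ih
  | exR _ ih => exact exR ih
  | exRInst e he _ ih => exact exRInst e he ih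
  | eqSubst s t hs ht _ _ ih₁ ih₂ => exact eqSubst s t hs ht ih₁ ih₂
  | real ψ σ h h' => exact real ψ σ h h'
  | G α _ ih => exact G α ih
  | K => exact K ..
  | V α φ h => exact V α φ h
  | diamond => exact diamond ..
  | assign v e φ h => exact assign v e φ h
  | diffConst => exact diffConst ..
  | diffVar => exact diffVar ..
  | diffAdd => exact diffAdd ..
  | diffMul => exact diffMul ..
  | diffApp => exact diffApp ..
  | DE => exact DE ..
  | DW => exact DW ..
  | DX o Q φ h => exact DX o Q φ h
  | DMP => exact DMP ..
  | barcan o Q v φ h h' => exact barcan o Q v φ h h'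
  | DIeq o Q e _ ih => exact DIeq o Q e fun x hx => ih x hx
  | DIge o Q e _ ih => exact DIge o Q e fun x hx => ih x hx
  | DIgt o Q e _ ih => exact DIgt o Q e fun x hx => ih x hx
  | DC => exact DC ..
  | DG o Q φ y a b hy h₁ h₂ h₃ h₄ h₅ => exact DG o Q φ y a b hy h₁ h₂ h₃ h₄ h₅
  | DGall o Q φ y a b hy h₁ h₂ h₃ h₄ h₅ => exact DGall o Q φ y a b hy h₁ h₂ h₃ h₄ h₅
  | Uniq hk' => cases hk'
  | Cont hk' => cases hk'

/-! ### Derived rules for programs and quantifiers -/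

theorem box_mono {α : Prog L.sig} (Δ : List (Fml L.sig))
    (hΔ : ∀ ψ ∈ Δ, Derivable L k Γ (.box α ψ)) (h : Derivable L k Δ φ) :
    Derivable L k Γ (.box α φ) := by
  induction Δ generalizing φ with
  | nil => exact G α h
  | cons ψ Δ ih =>
    exact mp (mp (K α ψ φ) (ih (fun χ hχ => hΔ χ (by simp [hχ])) (impR h))) (hΔ ψ (by simp))

theorem box_entail {α : Prog L.sig} (Δ : List (Fml L.sig))
    (hΔ : ∀ ψ ∈ Δ, Derivable L k Γ (.box α ψ))
    (h : ∀ M B, IsAlg M → (∀ ψ ∈ Δ, ψ.Sat M B) → φ.Sat M B) : Derivable L k Γ (.box α φ) :=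
  box_mono Δ hΔ (entail_ax h)

theorem box_const {α : Prog L.sig} (hd : Disjoint φ.fv α.bound) (h : Derivable L k Γ φ) :
    Derivable L k Γ (.box α φ) :=
  mp (V α φ hd) h

theorem of_ex {v : Var} (h : Derivable L k Γ (.ex v ψ)) (hΓ : ∀ χ ∈ Γ, v ∉ χ.fv) (hφ : v ∉ φ.fv)
    (h' : Derivable L k (ψ :: Γ) φ) : Derivable L k Γ φ :=
  cut h (exL hΓ hφ h')

/-- An instance of the valid formula `∃ v, v = w`. Through `of_eq` it supplies fresh constants with
prescribed values without any substitution. -/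
theorem ex_eq (v : Var) (t : Term L.sig) (hv : v ∉ Term.fv t) :
    Derivable L k Γ (.ex v (.eq v.toTerm t)) :=
  real (.ex v (.cmp .eq (.var v) (.schem ()))) (fun _ => t)
    (fun ρ μ => ⟨μ (), by simp [RFml.holds, Cmp.holds, RTerm.eval]⟩)
    (by simp [RFml.Admissible, hv])

theorem of_eq {v : Var} (t : Term L.sig) (hv : v ∉ Term.fv t) (hΓ : ∀ χ ∈ Γ, v ∉ χ.fv)
    (hφ : v ∉ φ.fv) (h : Derivable L k (.eq v.toTerm t :: Γ) φ) : Derivable L k Γ φ :=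
  of_ex (ex_eq v t hv) hΓ hφ h

theorem iff_mp (h : Derivable L k Γ (.iff φ ψ)) (h' : Derivable L k Γ φ) : Derivable L k Γ ψ :=
  mp (cut h (andL (ax (by simp)))) h'

theorem iff_mpr (h : Derivable L k Γ (.iff φ ψ)) (h' : Derivable L k Γ ψ) : Derivable L k Γ φ :=
  mp (cut h (andL (ax (by simp)))) h'

end Derivable

end DL

namespace DL

/-! ### Lie derivatives under algebraic valuations -/

theorem Tm.atoms_finite {S : Sig} {V : Type} (t : Tm S V) : t.atoms.Finite := by
  induction t with
  | atom v => exact Set.finite_singleton v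
  | const c => exact Set.finite_empty
  | add s t hs ht => exact hs.union ht
  | mul s t hs ht => exact hs.union ht
  | app h es ih => exact Set.finite_iUnion ih

namespace IsAlg

variable {S : Sig} {V : Type} {M : Tm S V → ℝ}

theorem zero (hM : IsAlg M) : M (.const 0) = 0 := by simp [hM.const]

theorem one (hM : IsAlg M) : M (.const 1) = 1 := by simp [hM.const]

theorem neg (hM : IsAlg M) (t : Tm S V) : M t.neg = - M t := by
  simp [Tm.neg, hM.mul, hM.const]

theorem sub (hM : IsAlg M) (s t : Tm S V) : M (s.sub t) = M s - M t := by
  simp [Tm.sub, hM.add, hM.neg, sub_eq_add_neg]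

theorem sum (hM : IsAlg M) (n : ℕ) (f : Fin n → Tm S V) : M (.sum n f) = ∑ i, M (f i) := by
  induction n with
  | zero => simp [Tm.sum, hM.const]
  | succ n ih => simp [Tm.sum, hM.add, ih, Fin.sum_univ_castSucc]

/-- The induced valuation of differential-free terms. -/
theorem toTerm {M : Term S → ℝ} (hM : IsAlg M) : IsAlg (fun e : DFTm S => M e.toTerm) :=
  ⟨hM.const, fun _ _ => hM.add _ _, fun _ _ => hM.mul _ _⟩

end IsAlg

section LieValues

variable {L : TermLang} {m : DFTm L.sig → ℝ} (hm : IsAlg m) (o : ODE L.sig)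
include hm

theorem pderiv_eq_zero {x : ℕ} (e : DFTm L.sig) (hx : x ∉ e.atoms) : m (L.pderiv x e) = 0 := by
  induction e with
  | atom y =>
    have : y ≠ x := fun h => hx (by simp [Tm.atoms, h])
    simp [TermLang.pderiv, this, hm.zero]
  | const c => exact hm.zero
  | add s t hs ht =>
    simp only [Tm.atoms, Set.mem_union, not_or] at hx
    simp [TermLang.pderiv, hm.add, hs hx.1, ht hx.2]
  | mul s t hs ht =>
    simp only [Tm.atoms, Set.mem_union, not_or] at hx
    simp [TermLang.pderiv, hm.add, hm.mul, hs hx.1, ht hx.2]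
  | app h es ih =>
    simp only [Tm.atoms, Set.mem_iUnion, not_exists] at hx
    simp [TermLang.pderiv, hm.sum, hm.mul, ih _ (hx _)]

/-- The rules of differentiation fail as syntactic identities of terms; they are stated for the
values under an algebraic valuation, which is all that `entail` needs. -/
theorem lie_eq (e : DFTm L.sig) :
    m (L.lie o e) = ∑ i, m (L.pderiv (o.vars i) e) * m (o.rhs i) := by
  simp [TermLang.lie, hm.sum, hm.mul]

theorem lie_const (c : ℚ) : m (L.lie o (.const c)) = 0 := by
  simp [lie_eq hm, TermLang.pderiv, hm.zero]

theorem lie_add (s t : DFTm L.sig) : m (L.lie o (.add s t)) = m (L.lie o s) + m (L.lie o t) := by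
  simp [lie_eq hm, TermLang.pderiv, hm.add, add_mul, Finset.sum_add_distrib]

theorem lie_mul (s t : DFTm L.sig) :
    m (L.lie o (.mul s t)) = m (L.lie o s) * m t + m s * m (L.lie o t) := by
  simp only [lie_eq hm, TermLang.pderiv, hm.add, hm.mul, Finset.sum_mul, Finset.mul_sum,
    ← Finset.sum_add_distrib]
  exact Finset.sum_congr rfl fun i _ => by ring

theorem lie_neg (t : DFTm L.sig) : m (L.lie o t.neg) = - m (L.lie o t) := by
  simp [Tm.neg, lie_mul hm, lie_const hm, hm.const]

theorem lie_sub (s t : DFTm L.sig) : m (L.lie o (s.sub t)) = m (L.lie o s) - m (L.lie o t) := by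
  simp [Tm.sub, lie_add hm, lie_neg hm, sub_eq_add_neg]

theorem lie_sum (n : ℕ) (f : Fin n → DFTm L.sig) :
    m (L.lie o (.sum n f)) = ∑ i, m (L.lie o (f i)) := by
  induction n with
  | zero => simp [Tm.sum, lie_const hm]
  | succ n ih => simp [Tm.sum, lie_add hm, ih, Fin.sum_univ_castSucc]

theorem lie_var (i : Fin o.dim) : m (L.lie o (.atom (o.vars i))) = m (o.rhs i) := by
  rw [lie_eq hm, Finset.sum_eq_single i]
  · simp [TermLang.pderiv, hm.one]
  · intro j _ hj
    have : o.vars i ≠ o.vars j := fun h => hj (o.vars_inj h).symm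
    simp [TermLang.pderiv, this, hm.zero]
  · simp

theorem lie_eq_zero (e : DFTm L.sig) (h : ∀ i, o.vars i ∉ e.atoms) : m (L.lie o e) = 0 := by
  rw [lie_eq hm]
  exact Finset.sum_eq_zero fun i _ => by rw [pderiv_eq_zero hm e (h i), zero_mul]

theorem lie_param {x : ℕ} (h : ∀ i, o.vars i ≠ x) : m (L.lie o (.atom x)) = 0 :=
  lie_eq_zero hm o _ (by simpa [Tm.atoms] using h)

theorem lie_extend {y : ℕ} (hy : o.Fresh y) (t e : DFTm L.sig) (he : y ∉ e.atoms) :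
    m (L.lie (o.extend y hy t) e) = m (L.lie o e) := by
  rw [lie_eq hm, lie_eq hm]
  change ∑ i : Fin (o.dim + 1), _ = _
  rw [Fin.sum_univ_castSucc]
  simp [ODE.extend, pderiv_eq_zero hm e he]

theorem lie_extend_new {y : ℕ} (hy : o.Fresh y) (t : DFTm L.sig) :
    m (L.lie (o.extend y hy t) (.atom y)) = m t := by
  have := lie_var hm (o.extend y hy t) (Fin.last o.dim)
  simpa [ODE.extend] using this

end LieValues

/-! ### Computing differentials -/

/-- The differential of a term, written with differential variables. -/
def TermLang.dterm (L : TermLang) : DFTm L.sig → Term L.sig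
  | .atom x => (Var.prime x).toTerm
  | .const _ => .const 0
  | .add s t => .add (dterm L s) (dterm L t)
  | .mul s t => .add (.mul (dterm L s) (DFTm.toTerm t)) (.mul (DFTm.toTerm s) (dterm L t))
  | .app h es => .sum _ (fun i => .mul (DFTm.toTerm ((L.partialTerm h i).bind es)) (dterm L (es i)))

/-- The total differential, evaluated at `x_i' = f_i` and at `x' = 0` for parameters, is the
derivative along the vector field. -/
theorem dterm_eq_lie {L : TermLang} {M : Term L.sig → ℝ} (hM : IsAlg M) (o : ODE L.sig)
    (hv : ∀ i, M (Var.prime (o.vars i)).toTerm = M (o.rhs i).toTerm) (e : DFTm L.sig)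
    (hp : ∀ x, o.ConstOutside e x → M (Var.prime x).toTerm = 0) :
    M (L.dterm e) = M (L.lie o e).toTerm := by
  induction e with
  | atom x =>
    by_cases hx : ∃ i, o.vars i = x
    · obtain ⟨i, rfl⟩ := hx
      exact (hv i).trans (lie_var hM.toTerm o i).symm
    · push Not at hx
      exact (hp x ⟨rfl, hx⟩).trans (lie_param hM.toTerm o hx).symm
  | const c => exact hM.zero.trans (lie_const hM.toTerm o c).symm
  | add s t hs ht =>
    rw [TermLang.dterm, hM.add, hs fun x hx => hp x ⟨Or.inl hx.1, hx.2⟩,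
      ht fun x hx => hp x ⟨Or.inr hx.1, hx.2⟩]
    exact (lie_add hM.toTerm o s t).symm
  | mul s t hs ht =>
    rw [TermLang.dterm, hM.add, hM.mul, hM.mul, hs fun x hx => hp x ⟨Or.inl hx.1, hx.2⟩,
      ht fun x hx => hp x ⟨Or.inr hx.1, hx.2⟩]
    exact (lie_mul hM.toTerm o s t).symm
  | app h es ih =>
    have ih' := fun i => ih i fun x hx => hp x ⟨Set.mem_iUnion.2 ⟨i, hx.1⟩, hx.2⟩
    -- Chain rule: the sum over system variables is exchanged with the sum over the arguments of
    -- `h`.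
    have key := lie_eq hM.toTerm o (.app h es)
    simp only [TermLang.pderiv, hM.toTerm.sum, hM.toTerm.mul, Finset.sum_mul] at key
    rw [key, Finset.sum_comm, TermLang.dterm, hM.sum]
    refine Finset.sum_congr rfl fun i _ => ?_
    have := lie_eq hM.toTerm o (es i)
    rw [hM.mul, ih', this, Finset.mul_sum]
    exact Finset.sum_congr rfl fun j _ => by ring

namespace Derivable

variable {L : TermLang} {k : Calculus} {Γ Δ : List (Fml L.sig)} {φ ψ : Fml L.sig}

theorem diff_eq_dterm (e : DFTm L.sig) : Derivable L k Γ (.eq e.diff (L.dterm e)) := by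
  induction e with
  | atom x => exact diffVar x
  | const c => exact diffConst c
  | add s t hs ht =>
    refine entail [_, _, _] (by
      simp only [List.forall_mem_cons]
      exact ⟨diffAdd s t, hs, ht, by simp⟩) fun M B hM h => ?_
    simp_all [Fml.eq, Fml.Sat, Cmp.holds, hM.add, TermLang.dterm]
  | mul s t hs ht =>
    refine entail [_, _, _] (by
      simp only [List.forall_mem_cons]
      exact ⟨diffMul s t, hs, ht, by simp⟩) fun M B hM h => ?_
    simp_all [Fml.eq, Fml.Sat, Cmp.holds, hM.add, hM.mul, TermLang.dterm]
  | app f es ih =>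
    refine entail (_ :: (List.finRange _).map fun i => .eq (DFTm.diff (es i)) (L.dterm (es i))) (by
      simp only [List.forall_mem_cons]
      refine ⟨diffApp f es, fun ψ hψ => ?_⟩
      obtain ⟨i, -, rfl⟩ := List.mem_map.1 hψ
      exact ih i) fun M B hM h => ?_
    simp_all [Fml.eq, Fml.Sat, Cmp.holds, hM.sum, hM.mul, TermLang.dterm]

theorem _root_.DL.Term.freeFor_toTerm {S : Sig} (v : Var) (e : DFTm S) :
    Term.FreeFor v e.toTerm := by
  intro s hs
  exfalso
  induction e with
  | atom x => simp [DFTm.toTerm, Tm.bind, Tm.atoms] at hs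
  | const c => simp [DFTm.toTerm, Tm.bind, Tm.atoms] at hs
  | add s t ihs iht => exact hs.elim ihs iht
  | mul s t ihs iht => exact hs.elim ihs iht
  | app h es ih =>
    obtain ⟨i, hi⟩ := Set.mem_iUnion.1 hs
    exact ih i hi

theorem _root_.DL.Term.subst_prime_toTerm {S : Sig} (x : ℕ) (e t : DFTm S) :
    Term.subst (.prime x) e t.toTerm = t.toTerm := by
  induction t with
  | atom y => simp [DFTm.toTerm, Term.subst, Tm.bind, Var.toTerm]
  | const c => rfl
  | add s t hs ht => exact congrArg₂ Tm.add hs ht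
  | mul s t hs ht => exact congrArg₂ Tm.mul hs ht
  | app h es ih => exact congrArg (Tm.app h) (funext ih)

theorem _root_.DL.Term.fv_toTerm {S : Sig} (e : DFTm S) :
    Term.fv e.toTerm = Var.base '' e.atoms := by
  have : (e.toTerm).atoms = (fun x => Atom.var (.base x)) '' e.atoms := by
    induction e with
    | atom x => simp [DFTm.toTerm, Tm.bind, Tm.atoms]
    | const c => simp [DFTm.toTerm, Tm.bind, Tm.atoms]
    | add s t hs ht => exact (congrArg₂ (· ∪ ·) hs ht).trans (Set.image_union ..).symm
    | mul s t hs ht => exact (congrArg₂ (· ∪ ·) hs ht).trans (Set.image_union ..).symm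
    | app h es ih => exact (Set.iUnion_congr ih).trans (Set.image_iUnion ..).symm
  ext v
  simp [Term.fv, this, Atom.fv, eq_comm]

theorem _root_.DL.Term.fv_var {S : Sig} (v : Var) : Term.fv (v.toTerm : Term S) = {v} := by
  simp [Term.fv, Var.toTerm, Tm.atoms, Atom.fv]

/-- The `i`-th assignment establishes the equation; the later ones set other differential variables,
and a right-hand side contains none, so V carries the equation through. -/
theorem boxAssign_eq (o : ODE L.sig) (i : Fin o.dim) :
    Derivable L k Γ (o.boxAssign (.eq (Var.prime (o.vars i)).toTerm (o.rhs i).toTerm)) := by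
  set P : Fml L.sig := .eq (Var.prime (o.vars i)).toTerm (o.rhs i).toTerm with hP
  have keep : ∀ l : List (Fin o.dim), i ∉ l → Derivable L k [] (.imp P (l.foldr
      (fun i ψ => .box (.assign (.prime (o.vars i)) (o.rhs i)) ψ) P)) := by
    intro l hl
    induction l with
    | nil => exact impR (ax (by simp))
    | cons j l ih =>
      simp only [List.mem_cons, not_or] at hl
      refine impR (mp (mp (K _ _ _) (G _ (ih hl.2))) (mp (V _ _ ?_) (ax (by simp))))
      have : o.vars i ≠ o.vars j := fun h => hl.1 (o.vars_inj h)
      simp [hP, Fml.eq, Fml.fv, Term.fv_var, Term.fv_toTerm, Prog.bound, this.symm]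
  have main : ∀ l : List (Fin o.dim), i ∈ l → Derivable L k [] (l.foldr
      (fun i ψ => .box (.assign (.prime (o.vars i)) (o.rhs i)) ψ) P) := by
    intro l hl
    induction l with
    | nil => simp at hl
    | cons j l ih =>
      by_cases hi : i ∈ l
      · exact G _ (ih hi)
      · obtain rfl : i = j := by simpa [hi] using hl
        refine mp (mp (K _ P _) (G _ (keep l hi))) (iff_mpr (assign _ _ _ ?_) ?_)
        · refine ⟨?_, Term.freeFor_toTerm _ _⟩
          intro s hs
          simp [Var.toTerm, Tm.atoms] at hs
        · simp only [hP, Fml.eq, Fml.subst, Term.subst_prime_toTerm]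
          refine entail_ax fun M B _ _ => ?_
          simp [Fml.Sat, Cmp.holds, Term.subst, Var.toTerm, Tm.bind]
  exact ofNil (main _ (List.mem_finRange i))

theorem box_prime_eq (o : ODE L.sig) (Q : Dom L.sig) (i : Fin o.dim) :
    Derivable L k Γ (.box (.ode o Q) (.eq (Var.prime (o.vars i)).toTerm (o.rhs i).toTerm)) :=
  iff_mpr (DE o Q _) (G _ (boxAssign_eq o i))

/-- Along a system, the differential of a term equals its Lie derivative. -/
theorem box_diff_eq_lie (o : ODE L.sig) (Q : Dom L.sig) (e : DFTm L.sig)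
    (hz : ∀ x, o.ConstOutside e x → Derivable L k Γ (.eq (Var.prime x).toTerm (.const 0))) :
    Derivable L k Γ (.box (.ode o Q) (.eq e.diff (L.lie o e).toTerm)) := by
  classical
  let l₁ : List (Fml L.sig) := (List.finRange o.dim).map fun i =>
    .eq (Var.prime (o.vars i)).toTerm (o.rhs i).toTerm
  let l₂ : List (Fml L.sig) := (e.atoms_finite.toFinset.toList.filter
    fun x => ∀ i, o.vars i ≠ x).map fun x => .eq (Var.prime x).toTerm (.const 0)
  -- The equations `x_i' = f_i` hold inside the box by DE; the equations `x' = 0` of parameters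
  -- enter it by V, since the system does not bind these `x'`.
  refine box_mono (l₁ ++ l₂) ?_ (entail (.eq e.diff (L.dterm e) :: (l₁ ++ l₂)) ?_ ?_)
  · intro ψ hψ
    rcases List.mem_append.1 hψ with hψ | hψ
    · obtain ⟨i, -, rfl⟩ := List.mem_map.1 hψ
      exact box_prime_eq o Q i
    · obtain ⟨x, hx, rfl⟩ := List.mem_map.1 hψ
      simp only [List.mem_filter, Finset.mem_toList, Set.Finite.mem_toFinset,
        decide_eq_true_eq] at hx
      refine box_const ?_ (hz x hx)
      have h0 : Term.fv (.const 0 : Term L.sig) = ∅ := by simp [Term.fv, Tm.atoms]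
      simpa [Fml.eq, Fml.fv, Term.fv_var, h0, Prog.bound, ODE.bound, eq_comm] using hx.2
  · rintro ψ (_ | ⟨_, hψ⟩)
    · exact diff_eq_dterm e
    · exact ax hψ
  · intro M B hM h
    have h1 : M e.diff = M (L.dterm e) := h (.eq e.diff (L.dterm e)) (by simp)
    refine h1.trans (dterm_eq_lie hM o (fun i => ?_) e fun x hx => ?_)
    · exact h (.eq (Var.prime (o.vars i)).toTerm (o.rhs i).toTerm) (by simp [l₁])
    · refine (h (.eq (Var.prime x).toTerm (.const 0)) ?_).trans hM.zero
      refine List.mem_cons_of_mem _ (List.mem_append_right _ (List.mem_map.2 ⟨x, ?_, rfl⟩))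
      simpa [ODE.ConstOutside] using hx

/-- Differential induction for `e ≥ 0`, in terms of the Lie derivative. -/
theorem dI_ge (o : ODE L.sig) (Q : Dom L.sig) (e : DFTm L.sig)
    (hz : ∀ x, o.ConstOutside e x → Derivable L k Γ (.eq (Var.prime x).toTerm (.const 0)))
    (h₀ : Derivable L k Γ (.imp Q.toFml (.cmpZero .ge e)))
    (h : Derivable L k Γ (.box (.ode o Q) (.cmpZero .ge (L.lie o e)))) :
    Derivable L k Γ (.box (.ode o Q) (.cmpZero .ge e)) := by
  refine iff_mpr (mp (DIge o Q e hz) ?_) h₀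
  refine box_entail [_, _] (by
    simp only [List.forall_mem_cons]
    exact ⟨box_diff_eq_lie o Q e hz, h, by simp⟩) fun M B hM h => ?_
  simp_all [Fml.eq, Fml.cmpZero, Fml.Sat, Cmp.holds]

/-- Differential induction for `e = 0`, in terms of the Lie derivative. -/
theorem dI_eq (o : ODE L.sig) (Q : Dom L.sig) (e : DFTm L.sig)
    (hz : ∀ x, o.ConstOutside e x → Derivable L k Γ (.eq (Var.prime x).toTerm (.const 0)))
    (h₀ : Derivable L k Γ (.imp Q.toFml (.eqZero e)))
    (h : Derivable L k Γ (.box (.ode o Q) (.eqZero (L.lie o e)))) :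
    Derivable L k Γ (.box (.ode o Q) (.eqZero e)) := by
  refine iff_mpr (mp (DIeq o Q e hz) ?_) h₀
  refine box_entail [_, _] (by
    simp only [List.forall_mem_cons]
    exact ⟨box_diff_eq_lie o Q e hz, h, by simp⟩) fun M B hM h => ?_
  simp_all [Fml.eq, Fml.eqZero, Fml.cmpZero, Fml.Sat, Cmp.holds]

end Derivable

end DL

namespace DL

/-! ### Truth conditions of derived connectives and comparisons with zero. -/

section Sat

variable {S : Sig} {M : Term S → ℝ} {B : Fml S → Prop}

theorem Fml.sat_imp {φ ψ : Fml S} : (φ.imp ψ).Sat M B ↔ (φ.Sat M B → ψ.Sat M B) :=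
  imp_iff_not_or.symm

theorem Fml.sat_iff {φ ψ : Fml S} : (φ.iff ψ).Sat M B ↔ (φ.Sat M B ↔ ψ.Sat M B) := by
  simp [iff, Sat, sat_imp, iff_def]

theorem Fml.sat_eq {s t : Term S} : (Fml.eq s t).Sat M B ↔ M s = M t := Iff.rfl

theorem Fml.sat_eqZero (hM : IsAlg M) {e : DFTm S} : (Fml.eqZero e).Sat M B ↔ M e.toTerm = 0 := by
  simp [eqZero, cmpZero, Sat, Cmp.holds, hM.zero]

theorem Fml.sat_geZero (hM : IsAlg M) {e : DFTm S} :
    (Fml.cmpZero .ge e).Sat M B ↔ 0 ≤ M e.toTerm := by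
  simp [cmpZero, Sat, Cmp.holds, hM.zero]

theorem Fml.sat_gtZero (hM : IsAlg M) {e : DFTm S} :
    (Fml.cmpZero .gt e).Sat M B ↔ 0 < M e.toTerm := by
  simp [cmpZero, Sat, Cmp.holds, hM.zero]

theorem Fml.sat_bigAnd (n : ℕ) (F : Fin n → Fml S) :
    (Fml.bigAnd n F).Sat M B ↔ ∀ i, (F i).Sat M B := by
  induction n with
  | zero => simp [bigAnd, tru, sat_eq]
  | succ n ih => simp [bigAnd, Sat, ih, Fin.forall_fin_succ']

end Sat

/-! ### Bounds on the variables in use -/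

/-- All variables that occur in the system are smaller than `m`. -/
def ODE.Below {S : Sig} (o : ODE S) (m : ℕ) : Prop :=
  (∀ i, o.vars i < m) ∧ ∀ i, ∀ x ∈ (o.rhs i).atoms, x < m

theorem Dom.vars_finite {S : Sig} (Q : Dom S) : Q.vars.Finite := by
  induction Q with
  | cmp c s t => exact s.atoms_finite.union t.atoms_finite
  | not Q ih => exact ih
  | and Q R h h' => exact h.union h'
  | or Q R h h' => exact h.union h'

/-- Only finitely many variables are in use, so everything from some index on is available for
ghosts and constants. -/
theorem exists_bound {S : Sig} (o : ODE S) (Q : Dom S) (n : ℕ) (p : ℕ → DFTm S) :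
    ∃ m, o.Below m ∧ (∀ x ∈ Q.vars, x < m) ∧ ∀ i ≤ n, ∀ x ∈ (p i).atoms, x < m := by
  have hfin : ((Set.range o.vars ∪ ⋃ i, (o.rhs i).atoms) ∪ Q.vars ∪
      ⋃ i : Fin (n + 1), (p i).atoms).Finite :=
    (((Set.finite_range _).union (Set.finite_iUnion fun i => (o.rhs i).atoms_finite)).union
      Q.vars_finite).union (Set.finite_iUnion fun i => (p i).atoms_finite)
  obtain ⟨b, hb⟩ := hfin.bddAbove
  have hlt : ∀ x ∈ _, x < b + 1 := fun x hx => Nat.lt_succ_of_le (hb hx)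
  refine ⟨b + 1, ⟨fun i => hlt _ ?_, fun i x hx => hlt _ ?_⟩, fun x hx => hlt _ ?_,
    fun i hi x hx => hlt _ ?_⟩
  · exact Or.inl (Or.inl (Or.inl ⟨i, rfl⟩))
  · exact Or.inl (Or.inl (Or.inr (Set.mem_iUnion.2 ⟨i, hx⟩)))
  · exact Or.inl (Or.inr hx)
  · exact Or.inr (Set.mem_iUnion.2 ⟨⟨i, Nat.lt_succ_of_le hi⟩, hx⟩)

section FreeVariables

variable {S : Sig}

theorem Term.fv_const (c : ℚ) : Term.fv (.const c : Term S) = ∅ := by simp [Term.fv, Tm.atoms]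

theorem Fml.fv_cmpZero (c : Cmp) (e : DFTm S) : (Fml.cmpZero c e).fv = Var.base '' e.atoms := by
  simp [cmpZero, Fml.fv, Term.fv_toTerm, Term.fv_const]

theorem Fml.fv_toFml (Q : Dom S) : Q.toFml.fv = Var.base '' Q.vars := by
  induction Q with
  | cmp c s t => simp [Dom.toFml, Fml.fv, Dom.vars, Term.fv_toTerm, Set.image_union]
  | not Q ih => simpa [Dom.toFml, Fml.fv, Dom.vars] using ih
  | and Q R h h' => simp [Dom.toFml, Fml.fv, Dom.vars, h, h', Set.image_union]
  | or Q R h h' => simp [Dom.toFml, Fml.fv, Dom.vars, h, h', Set.image_union]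

/-- The free variables are base variables smaller than `m`. -/
def Fml.Below (m : ℕ) (φ : Fml S) : Prop := φ.fv ⊆ Var.base '' Set.Iio m

theorem Fml.Below.prime_notMem {m : ℕ} {φ : Fml S} (h : φ.Below m) (x : ℕ) :
    Var.prime x ∉ φ.fv := fun hx => by
  obtain ⟨y, -, hy⟩ := h hx
  cases hy

theorem Fml.Below.base_notMem {m : ℕ} {φ : Fml S} (h : φ.Below m) {x : ℕ} (hx : m ≤ x) :
    Var.base x ∉ φ.fv := fun hx' => by
  obtain ⟨y, hy, hy'⟩ := h hx'
  cases hy'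
  exact absurd hy (not_lt.2 hx)

theorem Fml.Below.mono {m n : ℕ} {φ : Fml S} (h : φ.Below m) (hmn : m ≤ n) : φ.Below n :=
  h.trans (Set.image_mono (Set.Iio_subset_Iio hmn))

theorem Fml.Below.and {m : ℕ} {φ ψ : Fml S} (h : φ.Below m) (h' : ψ.Below m) :
    (Fml.and φ ψ).Below m := Set.union_subset h h'

theorem Fml.Below.imp {m : ℕ} {φ ψ : Fml S} (h : φ.Below m) (h' : ψ.Below m) :
    (Fml.imp φ ψ).Below m := Set.union_subset h h'

theorem Fml.below_cmpZero {m : ℕ} (c : Cmp) {e : DFTm S} (h : ∀ x ∈ e.atoms, x < m) :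
    (Fml.cmpZero c e).Below m := by
  rw [Fml.Below, Fml.fv_cmpZero]
  exact Set.image_mono h

theorem Fml.below_toFml {m : ℕ} {Q : Dom S} (h : ∀ x ∈ Q.vars, x < m) : Q.toFml.Below m := by
  rw [Fml.Below, Fml.fv_toFml]
  exact Set.image_mono h

theorem Fml.below_fls (m : ℕ) : (Fml.fls : Fml S).Below m := by
  simp [Fml.Below, Fml.fls, Fml.eq, Fml.fv, Term.fv_const]

theorem Fml.below_bigAnd {m n : ℕ} {F : Fin n → Fml S} (h : ∀ i, (F i).Below m) :
    (Fml.bigAnd n F).Below m := by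
  induction n with
  | zero => simp [Fml.Below, bigAnd, tru, Fml.eq, Fml.fv, Term.fv_const]
  | succ n ih => exact (ih fun i => h _).and (h _)

theorem Fml.below_box {m : ℕ} {o : ODE S} {Q : Dom S} {φ : Fml S} (ho : o.Below m)
    (hQ : ∀ x ∈ Q.vars, x < m) (h : φ.Below m) : (Fml.box (.ode o Q) φ).Below m := by
  refine Set.union_subset (Set.union_subset (Set.union_subset ?_ ?_) (Set.image_mono hQ))
    (Set.sdiff_subset.trans h)
  · rintro _ ⟨i, rfl⟩
    exact ⟨_, ho.1 i, rfl⟩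
  · exact Set.iUnion_subset fun i => Set.image_mono (ho.2 i)

theorem ODE.Below.fresh {o : ODE S} {m x : ℕ} (h : o.Below m) (hx : m ≤ x) : o.Fresh x :=
  ⟨fun i hi => absurd (h.1 i) (by omega), fun i hi => absurd (h.2 i x hi) (by omega)⟩

theorem ODE.extend_vars_castSucc (o : ODE S) {y : ℕ} (hy : o.Fresh y) (t : DFTm S)
    (i : Fin o.dim) : (o.extend y hy t).vars i.castSucc = o.vars i := by
  simp [ODE.extend]

theorem ODE.extend_vars_last (o : ODE S) {y : ℕ} (hy : o.Fresh y) (t : DFTm S) :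
    (o.extend y hy t).vars (Fin.last o.dim) = y := by
  simp [ODE.extend]

theorem ODE.Below.extend {o : ODE S} {m : ℕ} (h : o.Below m) (hy : o.Fresh m) {t : DFTm S}
    (ht : ∀ x ∈ t.atoms, x < m + 1) : (o.extend m hy t).Below (m + 1) := by
  constructor
  · change ∀ i : Fin (o.dim + 1), _
    refine Fin.forall_fin_succ'.2 ⟨fun i => ?_, ?_⟩
    · have := h.1 i
      simp only [ODE.extend, Fin.snoc_castSucc]
      omega
    · simp [ODE.extend]
  · change ∀ i : Fin (o.dim + 1), _
    refine Fin.forall_fin_succ'.2 ⟨fun i x hx => ?_, fun x hx => ht x ?_⟩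
    · have := h.2 i x (by simpa [ODE.extend] using hx)
      omega
    · simpa [ODE.extend] using hx

end FreeVariables

/-! ### Darboux inequalities and sufficiency of the differential radical formula. -/

namespace Derivable

variable {L : TermLang} {k : Calculus} {Γ : List (Fml L.sig)} {φ : Fml L.sig}

/-- Differentials of parameters may be assumed to vanish. -/
theorem of_prime_zero (m : ℕ) (hΓ : ∀ χ ∈ Γ, ∀ x, Var.prime x ∉ χ.fv)
    (hφ : ∀ x, Var.prime x ∉ φ.fv)
    (h : Derivable L k ((List.range m).map (fun x => .eq (Var.prime x).toTerm (.const 0)) ++ Γ) φ) :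
    Derivable L k Γ φ := by
  induction m with
  | zero => exact h
  | succ m ih =>
    -- No differential variable is free in the original sequent, so each can serve as the
    -- eigenvariable of `∃ x', x' = 0`.
    refine ih (of_eq (v := .prime m) (.const 0) (by simp [Term.fv_const]) ?_ (hφ m)
      (weaken ?_ h))
    · intro χ hχ
      rcases List.mem_append.1 hχ with hχ | hχ
      · obtain ⟨x, hx, rfl⟩ := List.mem_map.1 hχ
        have := (List.mem_range.1 hx).ne'
        simpa [Fml.eq, Fml.fv, Term.fv_var, Term.fv_const] using this
      · exact hΓ χ hχ m
    · intro χ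
      simp only [List.range_succ, List.map_append, List.mem_append, List.mem_cons,
        List.map_cons, List.map_nil]
      tauto

/-- If `v' ≤ 2hv` is provable along the system, then `v ≤ 0` is an invariant. -/
theorem darboux_le (o : ODE L.sig) (Q : Dom L.sig) (v h : DFTm L.sig) (m : ℕ) (ho : o.Below m)
    (hQ : ∀ x ∈ Q.vars, x < m) (hv : ∀ x ∈ v.atoms, x < m) (hh : ∀ x ∈ h.atoms, x < m)
    (hΓ : ∀ χ ∈ Γ, ∀ x, m ≤ x → Var.base x ∉ χ.fv)
    (hz : ∀ x ∈ v.atoms, Derivable L k Γ (.eq (Var.prime x).toTerm (.const 0)))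
    (h₀ : Derivable L k Γ (.imp Q.toFml (.cmpZero .ge v.neg)))
    (hd : Derivable L k [] (.cmpZero .ge (.sub (.mul (.const 2) (.mul h v)) (L.lie o v)))) :
    Derivable L k Γ (.box (.ode o Q) (.cmpZero .ge v.neg)) := by
  -- The ghost `y` will satisfy `y' = -h y`, the ghost `z` will satisfy `z' = h z`; both start at 1.
  let y := m
  let z := m + 1
  have hvy : y ∉ v.atoms := fun hx => absurd (hv _ hx) (by simp [y])
  have hvz : z ∉ v.atoms := fun hx => absurd (hv _ hx) (by simp [z])
  have hhy : y ∉ h.atoms := fun hx => absurd (hh _ hx) (by simp [y])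
  have hhz : z ∉ h.atoms := fun hx => absurd (hh _ hx) (by simp [z])
  have hQy : y ∉ Q.vars := fun hx => absurd (hQ _ hx) (by simp [y])
  have hQz : z ∉ Q.vars := fun hx => absurd (hQ _ hx) (by simp [z])
  have hneg : ∀ t : DFTm L.sig, t.neg.atoms = t.atoms := fun t => by simp [Tm.neg, Tm.atoms]
  have hy : o.Fresh y := ho.fresh le_rfl
  let t₁ : DFTm L.sig := .add (.mul h.neg (.atom y)) (.const 0)
  have ho₁ : (o.extend y hy t₁).Below (m + 1) := by
    refine ho.extend hy fun x hx => ?_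
    simp only [t₁, Tm.atoms, hneg, Set.union_empty, Set.mem_union, Set.mem_singleton_iff] at hx
    rcases hx with hx | hx
    · exact (hh x hx).trans (Nat.lt_succ_self m)
    · exact hx ▸ Nat.lt_succ_self m
  let o₁ := o.extend y hy t₁
  have hz₁ : o₁.Fresh z := ho₁.fresh le_rfl
  let t₂ : DFTm L.sig := .add (.mul h (.atom z)) (.const 0)
  let o₂ := o₁.extend z hz₁ t₂
  have hφ : (Fml.cmpZero .ge v.neg).Below m :=
    Fml.below_cmpZero _ (by simpa [hneg] using hv)
  have hbox : (Fml.box (.ode o Q) (.cmpZero .ge v.neg)).Below m := Fml.below_box ho hQ hφ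
  refine of_eq (v := .base y) (.const 1) (by simp [Term.fv_const])
    (fun χ hχ => hΓ χ hχ y le_rfl) (hbox.base_notMem le_rfl) ?_
  refine of_eq (v := .base z) (.const 1) (by simp [Term.fv_const]) ?_
    (hbox.base_notMem (Nat.le_succ m)) ?_
  · rintro χ (_ | ⟨_, hχ⟩)
    · simp [Fml.eq, Fml.fv, Term.fv_var, Term.fv_const, y, z]
    · exact hΓ χ hχ z (Nat.le_succ m)
  set Γ' := Fml.eq (Var.base z).toTerm (.const 1) :: Fml.eq (Var.base y).toTerm (.const 1) :: Γ
  have hsub : Γ ⊆ Γ' := fun x hx => by simp [Γ', hx]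
  have hy1 : Derivable L k Γ' (.eq (Var.base y).toTerm (.const 1)) := ax (by simp [Γ'])
  have hz1 : Derivable L k Γ' (.eq (Var.base z).toTerm (.const 1)) := ax (by simp [Γ'])
  refine iff_mpr (DG o Q _ y h.neg (.const 0) hy hQy (by simpa [hneg] using hhy)
    (by simp [Tm.atoms]) (hφ.base_notMem le_rfl) (hφ.prime_notMem y)) (exR ?_)
  refine iff_mpr (DG o₁ Q _ z h (.const 0) hz₁ hQz hhz
    (by simp [Tm.atoms]) (hφ.base_notMem (Nat.le_succ m)) (hφ.prime_notMem z)) (exR ?_)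
  change Derivable L k Γ' (.box (.ode o₂ Q) _)
  have hlv : ∀ {w : DFTm L.sig → ℝ}, IsAlg w → w (L.lie o₂ v) = w (L.lie o v) := fun hw =>
    (lie_extend hw _ hz₁ _ v hvz).trans (lie_extend hw _ hy _ v hvy)
  have hly : ∀ {w : DFTm L.sig → ℝ}, IsAlg w → w (L.lie o₂ (.atom y)) = - w h * w (.atom y) :=
    fun hw => by
      refine (lie_extend hw _ hz₁ _ _ (by simp [Tm.atoms, y, z])).trans ?_
      rw [lie_extend_new hw]
      simp [t₁, hw.add, hw.mul, hw.neg, hw.zero]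
  have hlz : ∀ {w : DFTm L.sig → ℝ}, IsAlg w → w (L.lie o₂ (.atom z)) = w h * w (.atom z) :=
    fun hw => by
      rw [lie_extend_new hw]
      simp [t₂, hw.add, hw.mul, hw.zero]
  have hvars : ∀ x, (∀ i, o₂.vars i ≠ x) → x ≠ y ∧ x ≠ z := fun x hx => by
    refine ⟨fun h => hx (Fin.last o.dim).castSucc ?_, fun h => hx (Fin.last o₁.dim) ?_⟩
    · exact ((o₁.extend_vars_castSucc hz₁ t₂ _).trans (o.extend_vars_last hy t₁)).trans h.symm
    · exact (o₁.extend_vars_last hz₁ t₂).trans h.symm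
  -- The derivative of `-v y²` is `(2 h v - v') y²`, which is nonnegative; the factor 2 in `hd`
  -- comes from the square.
  have h₁ : Derivable L k Γ' (.box (.ode o₂ Q)
      (.cmpZero .ge (.mul v.neg (.mul (.atom y) (.atom y))))) := by
    refine dI_ge _ _ _ (fun x hx => ?_) ?_ (box_mono [] (by simp) (entail [_] (by
      simpa only [List.forall_mem_singleton] using hd) fun M B hM hs => ?_))
    · obtain ⟨hx, hx'⟩ := hx
      have := (hvars x hx').1
      simp only [Tm.atoms, hneg, Set.mem_union, Set.mem_singleton_iff, this, or_false] at hx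
      exact weaken hsub (hz x hx)
    · refine entail [_] (by simpa only [List.forall_mem_singleton] using weaken hsub h₀)
        fun M B hM hs => ?_
      simp only [List.forall_mem_singleton, Fml.sat_imp, Fml.sat_geZero hM, hM.toTerm.mul,
        hM.toTerm.neg] at hs ⊢
      exact fun hq => mul_nonneg (hs hq) (mul_self_nonneg _)
    · simp only [List.forall_mem_singleton, Fml.sat_geZero hM, hM.toTerm.mul, hM.toTerm.sub,
        hM.toTerm.const, lie_mul hM.toTerm, lie_neg hM.toTerm, hlv hM.toTerm,
        hly hM.toTerm, hM.toTerm.neg] at hs ⊢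
      have := mul_nonneg hs (mul_self_nonneg (M (DFTm.toTerm (.atom y))))
      push_cast at this
      linarith
  -- `(y z)' = -h y z + y h z = 0`, so `y z` keeps its initial value 1; hence `y ≠ 0`, and `y²` can
  -- be cancelled from `h₁`.
  have h₂ : Derivable L k Γ' (.box (.ode o₂ Q)
      (.eqZero (.sub (.mul (.atom y) (.atom z)) (.const 1)))) := by
    refine dI_eq _ _ _ (fun x hx => ?_) ?_ (box_entail [] (by simp) fun M B hM _ => ?_)
    · obtain ⟨hx, hx'⟩ := hx
      have := hvars x hx'
      simp [Tm.sub, Tm.neg, Tm.atoms, this.1, this.2] at hx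
    · refine entail [_, _] (by
        simp only [List.forall_mem_cons]
        exact ⟨hy1, hz1, by simp⟩) fun M B hM hs => ?_
      simp only [List.forall_mem_cons, Fml.sat_eq, hM.one] at hs
      simp only [Fml.sat_imp, Fml.sat_eqZero hM, hM.toTerm.mul, hM.toTerm.sub, hM.toTerm.one]
      intro _
      have e1 : M (DFTm.toTerm (.atom y)) = 1 := hs.1
      have e2 : M (DFTm.toTerm (.atom z)) = 1 := hs.2.1
      rw [e1, e2]
      norm_num
    · simp only [Fml.sat_eqZero hM, lie_mul hM.toTerm, lie_sub hM.toTerm, lie_const hM.toTerm,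
        hly hM.toTerm, hlz hM.toTerm]
      ring
  refine box_entail [_, _] (by
    simp only [List.forall_mem_cons]
    exact ⟨h₁, h₂, by simp⟩) fun M B hM hs => ?_
  simp only [List.forall_mem_cons, Fml.sat_eqZero hM, Fml.sat_geZero hM, hM.toTerm.mul,
    hM.toTerm.sub, hM.toTerm.neg, hM.toTerm.one] at hs ⊢
  obtain ⟨a, b, -⟩ := hs
  have hne : M (DFTm.toTerm (.atom y)) ≠ 0 := fun h0 => by
    rw [h0] at b
    norm_num at b
  have hpos := mul_self_pos.2 hne
  by_contra hc
  push Not at hc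
  linarith [mul_neg_of_neg_of_pos hc hpos]

/-- Cauchy–Schwarz bound for the square norm of a chain `p 0, ..., p (N - 1)` of successive
derivatives. -/
theorem _root_.DL.sum_chain_le (N : ℕ) (hN : 1 ≤ N) (p : ℕ → ℝ) (g : Fin N → ℝ)
    (h : p N = ∑ i, g i * p i) :
    ∑ i : Fin N, (p (i + 1) * p i + p i * p (i + 1)) ≤
      (3 + ∑ i, g i * g i) * ∑ i : Fin N, p i * p i := by
  obtain ⟨n, rfl⟩ := Nat.exists_eq_add_of_le' hN
  set V := ∑ i : Fin (n + 1), p i * p i with hV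
  have hlast : V = ∑ i : Fin n, p i * p i + p n * p n := by
    rw [hV, Fin.sum_univ_castSucc]; simp
  have hfirst : V = p 0 * p 0 + ∑ i : Fin n, p (i + 1) * p (i + 1) := by
    rw [hV, Fin.sum_univ_succ]; simp
  -- The inner terms contribute at most `2 V`, by `2ab ≤ a² + b²` and the two ways of splitting off
  -- an end of `V`.
  have h1 : ∑ i : Fin n, (p (i + 1) * p i + p i * p (i + 1)) ≤
      ∑ i : Fin n, (p i * p i + p (i + 1) * p (i + 1)) :=
    Finset.sum_le_sum fun i _ => by nlinarith [sq_nonneg (p i - p (i + 1))]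
  rw [Finset.sum_add_distrib (f := fun i : Fin n => p i * p i)] at h1
  -- The last term contributes at most `(∑ g_i²) V + V`: expand `p (n + 1)` by `h` and use `2 (g_i
  -- p_n) p_i ≤ (g_i p_n)² + p_i²`.
  have h2 : 2 * (p n * p (n + 1)) ≤ (∑ i, g i * g i) * (p n * p n) + V := by
    rw [h, hV, Finset.mul_sum, Finset.mul_sum, Finset.sum_mul, ← Finset.sum_add_distrib]
    refine Finset.sum_le_sum fun i _ => ?_
    nlinarith [sq_nonneg (g i * p n - p i)]
  have hG : 0 ≤ ∑ i, g i * g i := Finset.sum_nonneg fun i _ => mul_self_nonneg _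
  have hs : 0 ≤ ∑ i : Fin n, p i * p i := Finset.sum_nonneg fun i _ => mul_self_nonneg _
  have h3 := mul_le_mul_of_nonneg_left (show p n * p n ≤ V by linarith) hG
  rw [Fin.sum_univ_castSucc]
  simp only [Fin.val_castSucc, Fin.val_last]
  nlinarith [mul_self_nonneg (p 0), mul_self_nonneg (p n)]

/-- The differential radical formula implies that `e = 0` is an invariant. -/
theorem box_of_diffRadical {o : ODE L.sig} {e : DFTm L.sig} {N : ℕ} {g : Fin N → DFTm L.sig}
    (hN : L.DiffRadical o e N g) (Q : Dom L.sig) :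
    Derivable L k []
      (.imp (.imp Q.toFml (L.diffRadicalFml o e N)) (.box (.ode o Q) (.eqZero e))) := by
  obtain ⟨hN1, hrad⟩ := hN
  let p := L.lieN o e
  let v : DFTm L.sig := .sum N fun i => .mul (p i) (p i)
  let h : DFTm L.sig := .add (.const 3) (.sum N fun i => .mul (g i) (g i))
  -- One sequence collects the Lie derivatives up to order `N`, then `v` and `h`, so that a single
  -- bound serves all.
  obtain ⟨m, ho, hQ, hp⟩ := exists_bound o Q (N + 2)
    (fun i => if i ≤ N then p i else if i = N + 1 then v else h)
  have hpm : ∀ i ≤ N, ∀ x ∈ (p i).atoms, x < m := fun i hi => by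
    simpa [hi] using hp i (by omega)
  have hvm : ∀ x ∈ v.atoms, x < m := by simpa using hp (N + 1) (by omega)
  have hhm : ∀ x ∈ h.atoms, x < m := by simpa using hp (N + 2) (by omega)
  have hφ : (Fml.box (.ode o Q) (.eqZero e)).Below m :=
    Fml.below_box ho hQ (Fml.below_cmpZero _ (hpm 0 (by omega)))
  have hR : (Fml.imp Q.toFml (L.diffRadicalFml o e N)).Below m :=
    (Fml.below_toFml hQ).imp (Fml.below_bigAnd fun i => Fml.below_cmpZero _ (hpm i i.2.le))
  refine impR (of_prime_zero m (by simpa using hR.prime_notMem) hφ.prime_notMem ?_)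
  set Γ : List (Fml L.sig) := (List.range m).map (fun x => .eq (Var.prime x).toTerm (.const 0)) ++
    [.imp Q.toFml (L.diffRadicalFml o e N)] with hΓ
  suffices hv : Derivable L k Γ (.box (.ode o Q) (.cmpZero .ge v.neg)) by
    refine box_entail [_] (by simpa only [List.forall_mem_singleton] using hv) fun M B hM hs => ?_
    simp only [List.forall_mem_singleton, Fml.sat_geZero hM, Fml.sat_eqZero hM, hM.toTerm.neg, v,
      hM.toTerm.sum, hM.toTerm.mul] at hs ⊢
    have h0 := Finset.single_le_sum (f := fun i : Fin N => M (p i).toTerm * M (p i).toTerm)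
      (fun i _ => mul_self_nonneg _) (Finset.mem_univ (⟨0, hN1⟩ : Fin N))
    exact mul_self_eq_zero.1 (le_antisymm (h0.trans (by linarith)) (mul_self_nonneg _))
  refine darboux_le o Q v h m ho hQ hvm hhm ?_ ?_ ?_ ?_
  · intro χ hχ x hx
    rcases List.mem_append.1 hχ with hχ | hχ
    · obtain ⟨x, hx, rfl⟩ := List.mem_map.1 hχ
      simp [Fml.eq, Fml.fv, Term.fv_var, Term.fv_const]
    · rw [List.mem_singleton.1 hχ]
      exact hR.base_notMem hx
  · exact fun x hx => ax (List.mem_append_left _ (List.mem_map.2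
      ⟨x, List.mem_range.2 (hvm x hx), rfl⟩))
  · refine entail [.imp Q.toFml (L.diffRadicalFml o e N)] (by
      simpa only [List.forall_mem_singleton] using ax (by simp [Γ])) fun M B hM hs => ?_
    simp only [List.forall_mem_singleton, Fml.sat_imp, TermLang.diffRadicalFml, Fml.sat_bigAnd,
      Fml.sat_eqZero hM, Fml.sat_geZero hM, hM.toTerm.neg, v, hM.toTerm.sum, hM.toTerm.mul] at hs ⊢
    intro hq
    simp [p, hs hq]
  · refine entail [_] (by
      simpa only [List.forall_mem_singleton] using hrad.toExtended) fun M B hM hs => ?_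
    simp only [List.forall_mem_singleton, Fml.sat_eq, Fml.sat_geZero hM, hM.toTerm.sub, v, h,
      hM.toTerm.sum, hM.toTerm.mul, hM.toTerm.add, hM.toTerm.const, lie_sum hM.toTerm,
      lie_mul hM.toTerm] at hs ⊢
    have key := sum_chain_le N hN1 (fun i => M (p i).toTerm) (fun i => M (g i).toTerm) hs
    have hG : 0 ≤ ∑ i, M (g i).toTerm * M (g i).toTerm :=
      Finset.sum_nonneg fun i _ => mul_self_nonneg _
    have hV : 0 ≤ ∑ i : Fin N, M (p i).toTerm * M (p i).toTerm :=
      Finset.sum_nonneg fun i _ => mul_self_nonneg _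
    -- The estimate gives `v' ≤ h v`, while `darboux_le` asks for `v' ≤ 2 h v`; the gap is `h v ≥
    -- 0`.
    have hGV := mul_nonneg (add_nonneg (by norm_num : (0 : ℝ) ≤ 3) hG) hV
    change 0 ≤ _ - ∑ i : Fin N, (M (p (i + 1)).toTerm * M (p i).toTerm +
      M (p i).toTerm * M (p (i + 1)).toTerm)
    push_cast
    linarith

end Derivable

end DL

/-! ### Powers, monotonicity in the domain, and leaving the initial state. -/

namespace DL

/-- The power `t ^ n`. -/
def Tm.pow {S : Sig} {V : Type} (t : Tm S V) : ℕ → Tm S V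
  | 0 => .const 1
  | n + 1 => .mul (t.pow n) t

theorem Tm.atoms_pow {S : Sig} {V : Type} (t : Tm S V) (n : ℕ) : (t.pow n).atoms ⊆ t.atoms := by
  induction n with
  | zero => exact Set.empty_subset _
  | succ n ih => exact Set.union_subset ih subset_rfl

theorem Tm.atoms_sub {S : Sig} {V : Type} (s t : Tm S V) :
    (s.sub t).atoms = s.atoms ∪ t.atoms := by
  simp [Tm.sub, Tm.neg, Tm.atoms]

theorem Tm.atoms_sum {S : Sig} {V : Type} (n : ℕ) (f : Fin n → Tm S V) :
    (Tm.sum n f).atoms = ⋃ i, (f i).atoms := by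
  induction n with
  | zero => simp [Tm.sum, Tm.atoms]
  | succ n ih =>
    ext x
    simp [Tm.sum, Tm.atoms, ih, Fin.exists_fin_succ']

theorem IsAlg.pow {S : Sig} {V : Type} {M : Tm S V → ℝ} (hM : IsAlg M) (t : Tm S V) (n : ℕ) :
    M (t.pow n) = M t ^ n := by
  induction n with
  | zero => simp [Tm.pow, hM.one]
  | succ n ih => simp [Tm.pow, hM.mul, ih, pow_succ]

theorem lie_pow {L : TermLang} {w : DFTm L.sig → ℝ} (hw : IsAlg w) (o : ODE L.sig)
    (t : DFTm L.sig) (n : ℕ) :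
    w (L.lie o (Tm.pow t (n + 1))) = (n + 1) * w t ^ n * w (L.lie o t) := by
  induction n with
  | zero => simp [Tm.pow, lie_mul hw, lie_const hw, hw.one]
  | succ n ih =>
    rw [Tm.pow, lie_mul hw, ih, hw.pow]
    push_cast
    ring

namespace Derivable

variable {L : TermLang} {k : Calculus} {Γ : List (Fml L.sig)} {φ : Fml L.sig}

theorem box_dom_mono (o : ODE L.sig) {Q R : Dom L.sig}
    (h : ∀ M B, IsAlg M → R.toFml.Sat M B → Q.toFml.Sat M B) :
    Derivable L k Γ (.imp (.box (.ode o Q) φ) (.box (.ode o R) φ)) :=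
  mp (DMP o R Q φ) (G _ (entail_ax fun M B hM _ => Fml.sat_imp.2 (h M B hM)))

theorem dia_dom_mono (o : ODE L.sig) {Q R : Dom L.sig}
    (h : ∀ M B, IsAlg M → R.toFml.Sat M B → Q.toFml.Sat M B) :
    Derivable L k Γ (.imp (.dia (.ode o R) φ) (.dia (.ode o Q) φ)) := by
  refine entail [_, _, _] (by
    simp only [List.forall_mem_cons]
    exact ⟨diamond (.ode o R) φ, diamond (.ode o Q) φ, box_dom_mono o h (φ := .not φ),
      by simp⟩) fun M B hM hs => ?_
  simp only [List.forall_mem_cons, Fml.sat_imp, Fml.sat_iff, Fml.Sat] at hs ⊢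
  tauto

/-- A system without fixpoints can leave its initial state inside a strict domain. -/
theorem dia_strict (o : ODE L.sig) (y : Fin o.dim → ℕ)
    (hf : Derivable L .extended [] (.not (.bigAnd o.dim (fun i => .eqZero (o.rhs i)))))
    (hy : Function.Injective y) (ho : ∀ i, o.Fresh (y i)) {Q : Dom L.sig} (hQ : Q.Strict)
    (hQy : ∀ i, y i ∉ Q.vars) (hΓ : Derivable L .extended Γ (o.vecEq y)) :
    Derivable L .extended Γ (.imp Q.toFml (.dia (.ode o Q) (.not (o.vecEq y)))) := by
  -- Cont handles a single inequality `e > 0`, hence each domain equivalent to one: `s > t` is `s -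
  -- t > 0`, and `s ≠ t` is `(s - t)² > 0`. Conjunctions follow by Uniq, disjunctions by
  -- monotonicity in the domain.
  have pos : ∀ (e : DFTm L.sig), (∀ i, y i ∉ e.atoms) → ∀ Q : Dom L.sig,
      (∀ M B, IsAlg M → (Q.toFml.Sat M B ↔ 0 < M e.toTerm)) →
      Derivable L .extended Γ (.imp Q.toFml (.dia (.ode o Q) (.not (o.vecEq y)))) := by
    intro e he Q hQ
    refine entail [_, _] (by
      simp only [List.forall_mem_cons]
      exact ⟨mp (Cont rfl o e y hf hy ho he) hΓ, dia_dom_mono o (Q := Q)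
        (R := .cmp .gt e (.const 0)) (φ := .not (o.vecEq y)) fun M B hM h =>
          (hQ M B hM).2 ((Fml.sat_gtZero hM).1 h), by simp⟩) fun M B hM hs => ?_
    simp only [List.forall_mem_cons, Fml.sat_imp, Fml.sat_iff, Fml.sat_gtZero hM,
      hQ M B hM] at hs ⊢
    exact fun h => hs.2.1 (hs.1.2 h)
  induction hQ with
  | gt s t =>
    refine pos (s.sub t) (by simpa [Tm.atoms_sub, Dom.vars] using hQy) _ fun M B hM => ?_
    simp [Dom.toFml, Fml.Sat, Cmp.holds, hM.toTerm.sub]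
  | ne s t =>
    refine pos (.mul (s.sub t) (s.sub t))
      (by simpa [Tm.atoms_sub, Dom.vars, Tm.atoms] using hQy) _ fun M B hM => ?_
    simp only [Dom.toFml, Fml.Sat, Cmp.holds, hM.toTerm.sub, hM.toTerm.mul, mul_self_pos,
      sub_ne_zero, ne_eq]
  | @and Q R _ _ ih₁ ih₂ =>
    simp only [Dom.vars, Set.mem_union, not_or, forall_and] at hQy
    refine entail [_, _, _] (by
      simp only [List.forall_mem_cons]
      exact ⟨ih₁ hQy.1, ih₂ hQy.2, Uniq rfl o Q R (.not (o.vecEq y)), by simp⟩) fun M B hM hs => ?_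
    simp only [List.forall_mem_cons, Fml.sat_imp, Fml.sat_iff, Fml.Sat, Dom.toFml] at hs ⊢
    tauto
  | @or Q R _ _ ih₁ ih₂ =>
    simp only [Dom.vars, Set.mem_union, not_or, forall_and] at hQy
    refine entail [_, _, _, _] (by
      simp only [List.forall_mem_cons]
      exact ⟨ih₁ hQy.1, ih₂ hQy.2,
        dia_dom_mono o (R := Q) (Q := .or Q R) (φ := .not (o.vecEq y)) fun _ _ _ h => Or.inl h,
        dia_dom_mono o (R := R) (Q := .or Q R) (φ := .not (o.vecEq y)) fun _ _ _ h => Or.inr h,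
        by simp⟩) fun M B hM hs => ?_
    simp only [List.forall_mem_cons, Fml.sat_imp, Fml.Sat, Dom.toFml] at hs ⊢
    tauto

/-- Supplies the constant `ε` of `fls_of_pos`, with `a` the first nonvanishing derivative and `b`
the bound `1 + ∑ f_i²` on the speed. -/
theorem ex_small (v : ℕ) (a b : DFTm L.sig) (ha : v ∉ a.atoms) (hb : v ∉ b.atoms) :
    Derivable L k Γ (.imp (.cmpZero .gt a) (.ex (.base v)
      (.and (.cmpZero .gt (.atom v)) (.and (.cmpZero .gt (Tm.sub a (.atom v)))
        (.cmpZero .gt (.sub (.const 1) (.mul (.atom v) b))))))) := by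
  refine real (W := Bool) (.or (.not (.cmp .gt (.schem true) (.const 0))) (.ex (.base v)
    (.and (.cmp .gt (.var (.base v)) (.const 0)) (.and
      (.cmp .gt (.add (.schem true) (.mul (.const (-1)) (.var (.base v)))) (.const 0))
      (.cmp .gt (.add (.const 1) (.mul (.const (-1)) (.mul (.var (.base v)) (.schem false))))
        (.const 0))))))
    (fun c => bif c then a.toTerm else b.toTerm) ?_ ?_
  · intro ρ μ
    simp only [RFml.holds, Cmp.holds, RTerm.eval, Function.update_self]
    by_cases h : 0 < μ true
    · right
      have hd : 0 < 1 + |μ false| := by positivity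
      -- The halves make the inequalities strict; `1 + |b|` replaces `b` because `b` may be zero or
      -- negative.
      refine ⟨min (μ true / 2) ((1 + |μ false|)⁻¹ / 2), ?_, ?_, ?_⟩
      · simpa using ⟨h, hd⟩
      · have := min_le_left (μ true / 2) ((1 + |μ false|)⁻¹ / 2)
        push_cast
        linarith
      · set ε := min (μ true / 2) ((1 + |μ false|)⁻¹ / 2) with hε
        have h0 : 0 ≤ ε := le_min (by positivity) (by positivity)
        have h1 : ε * μ false ≤ (1 + |μ false|)⁻¹ / 2 * (1 + |μ false|) :=
          (mul_le_mul_of_nonneg_left (by linarith [le_abs_self (μ false)]) h0).trans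
            (mul_le_mul_of_nonneg_right (min_le_right _ _) hd.le)
        rw [div_mul_eq_mul_div, inv_mul_cancel₀ hd.ne'] at h1
        push_cast
        linarith
    · left
      simpa using h
  · have hav : Var.base v ∉ Term.fv a.toTerm := by simpa [Term.fv_toTerm] using ha
    have hbv : Var.base v ∉ Term.fv b.toTerm := by simpa [Term.fv_toTerm] using hb
    simp [RFml.Admissible, RFml.schems, RTerm.schems, hav, hbv]

/-- Fresh copies of variables. -/
theorem of_vecEq {n : ℕ} (x : Fin n → ℕ) (c : ℕ) (hx : ∀ i, x i < c)
    (hΓ : ∀ χ ∈ Γ, χ.Below c) (hφ : φ.Below c)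
    (h : Derivable L k (.bigAnd n (fun i =>
      .eq (Var.base (x i)).toTerm (Var.base (c + i)).toTerm) :: Γ) φ) :
    Derivable L k Γ φ := by
  induction n with
  | zero => exact cut (ψ := .tru) (entail_ax fun M B _ _ => show Fml.Sat M B .tru from rfl) h
  | succ n ih =>
    refine ih (fun i => x i.castSucc) (fun i => hx _) (of_eq (v := .base (c + n))
      (Var.base (x (Fin.last n))).toTerm ?_ ?_ (hφ.base_notMem (by omega)) ?_)
    · have := hx (Fin.last n)
      simp only [Term.fv_var, Set.mem_singleton_iff, Var.base.injEq]
      omega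
    · rintro χ (_ | ⟨_, hχ⟩)
      · have : (Fml.bigAnd n fun i => (.eq (Var.base (x i.castSucc)).toTerm
            (Var.base (c + i)).toTerm : Fml L.sig)).Below (c + n) := by
          refine Fml.below_bigAnd fun i => ?_
          have := hx i.castSucc
          refine Set.union_subset ?_ ?_
          · rw [Term.fv_var, Set.singleton_subset_iff]
            exact ⟨_, by simp only [Set.mem_Iio]; omega, rfl⟩
          · rw [Term.fv_var, Set.singleton_subset_iff]
            exact ⟨_, by simp only [Set.mem_Iio]; omega, rfl⟩
        exact this.base_notMem le_rfl
      · exact (hΓ χ hχ).base_notMem (by omega)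
    · refine cut (ψ := .bigAnd (n + 1) fun i => .eq (Var.base (x i)).toTerm
        (Var.base (c + i)).toTerm) (entail_ax fun M B _ hs => ?_) (weaken ?_ h)
      · refine ⟨hs _ (List.mem_cons_of_mem _ List.mem_cons_self), ?_⟩
        have : M (Var.base (c + n)).toTerm = M (Var.base (x (Fin.last n))).toTerm :=
          hs _ List.mem_cons_self
        exact this.symm
      · intro χ
        simp only [List.mem_cons]
        tauto

end Derivable

end DL

/-! ### Clocks, Taylor growth, and necessity of the differential radical formula. -/

namespace DL

namespace Derivable

variable {L : TermLang} {k : Calculus} {Γ : List (Fml L.sig)} {φ : Fml L.sig}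

/-- The elapsed time `x_c - y_c` of a clock. -/
def _root_.DL.ODE.elapsed {S : Sig} (o : ODE S) (c : Fin o.dim) (y : Fin o.dim → ℕ) : DFTm S :=
  .sub (.atom (o.vars c)) (.atom (y c))

theorem _root_.DL.lie_elapsed {w : DFTm L.sig → ℝ} (hw : IsAlg w) {o : ODE L.sig} {c : Fin o.dim}
    {y : Fin o.dim → ℕ} (hc : w (o.rhs c) = 1) (hy : ∀ i, o.Fresh (y i)) :
    w (L.lie o (o.elapsed c y)) = 1 := by
  rw [ODE.elapsed, lie_sub hw, lie_var hw, hc, lie_param hw o (hy c).1, sub_zero]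

theorem _root_.DL.sat_vecEq {S : Sig} {M : Term S → ℝ} {B : Fml S → Prop} {o : ODE S}
    {y : Fin o.dim → ℕ} :
    (o.vecEq y).Sat M B ↔
      ∀ i, M (DFTm.toTerm (.atom (o.vars i))) = M (DFTm.toTerm (.atom (y i))) :=
  Fml.sat_bigAnd _ _

/-- If time elapses and the right-hand sides are bounded by `1 / ε`, then each variable has moved
by at most the elapsed time divided by `ε`. -/
theorem box_speed (o : ODE L.sig) (R : Dom L.sig) (c i : Fin o.dim) (y : Fin o.dim → ℕ) (ε : ℕ)
    (s : ℚ) (hs : s = 1 ∨ s = -1) (hc : ∀ w : DFTm L.sig → ℝ, IsAlg w → w (o.rhs c) = 1)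
    (hy : ∀ i, o.Fresh (y i)) (hε : ∀ i, o.vars i ≠ ε)
    (hz : ∀ x, (x = ε ∨ ∃ j, x = y j) → Derivable L k Γ (.eq (Var.prime x).toTerm (.const 0)))
    (heq : Derivable L k Γ (o.vecEq y)) (hpos : Derivable L k Γ (.cmpZero .gt (.atom ε)))
    (hR : ∀ M B, IsAlg M → R.toFml.Sat M B → 0 < M (DFTm.toTerm (.sub (.const 1)
      (.mul (.atom ε) (.add (.const 1) (.sum o.dim fun i => .mul (o.rhs i) (o.rhs i))))))) :
    Derivable L k Γ (.box (.ode o R) (.cmpZero .ge (.add (o.elapsed c y)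
      (.mul (.const s) (.mul (.atom ε) (.sub (.atom (o.vars i)) (.atom (y i)))))))) := by
  refine dI_ge _ _ _ (fun x hx => hz x ?_) ?_ ?_
  · obtain ⟨hx, hx'⟩ := hx
    simp only [Tm.atoms, ODE.elapsed, Tm.atoms_sub, Set.mem_union, Set.mem_singleton_iff,
      Set.mem_empty_iff_false, false_or] at hx
    rcases hx with (h | h) | h | h | h
    · exact absurd h.symm (hx' c)
    · exact Or.inr ⟨c, h⟩
    · exact Or.inl h
    · exact absurd h.symm (hx' i)
    · exact Or.inr ⟨i, h⟩
  · refine entail [_] (by simpa only [List.forall_mem_singleton] using heq) fun M B hM h => ?_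
    simp only [List.forall_mem_singleton, sat_vecEq] at h
    simp only [Fml.sat_imp, Fml.sat_geZero hM, ODE.elapsed, hM.toTerm.add, hM.toTerm.mul,
      hM.toTerm.sub, h]
    simp
  · have hposb : Derivable L k Γ (.box (.ode o R) (.cmpZero .gt (.atom ε))) := by
      refine box_const ?_ hpos
      simpa [Fml.fv_cmpZero, Tm.atoms, Prog.bound, ODE.bound, eq_comm] using hε
    refine box_entail [_, _] (by
      simp only [List.forall_mem_cons]
      exact ⟨DW o R, hposb, by simp⟩) fun M B hM h => ?_
    simp only [List.forall_mem_cons, Fml.sat_gtZero hM] at h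
    obtain ⟨h1, h2, -⟩ := h
    have h3 := hR M B hM h1
    simp only [hM.toTerm.add, hM.toTerm.mul, hM.toTerm.sub, hM.toTerm.sum, hM.toTerm.one] at h3
    simp only [Fml.sat_geZero hM, lie_add hM.toTerm, lie_mul hM.toTerm, lie_sub hM.toTerm,
      lie_const hM.toTerm, lie_var hM.toTerm, lie_param hM.toTerm o (hy i).1,
      lie_param hM.toTerm o hε, lie_elapsed hM.toTerm (hc _ hM.toTerm) hy, hM.toTerm.const]
    have h4 := Finset.single_le_sum (f := fun i => M (o.rhs i).toTerm * M (o.rhs i).toTerm)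
      (fun i _ => mul_self_nonneg _) (Finset.mem_univ i)
    have h5 := mul_le_mul_of_nonneg_left h4 h2.le
    set f := M (o.rhs i).toTerm
    set E := M (DFTm.toTerm (.atom ε))
    -- From `ε (f ∓ 1)² ≥ 0` follows `2 ε |f| ≤ ε (1 + f²) < 1`, so the derivative `1 + s ε f` is
    -- positive for both signs `s`.
    have h6 := mul_nonneg h2.le (mul_self_nonneg (f - 1))
    have h7 := mul_nonneg h2.le (mul_self_nonneg (f + 1))
    rcases hs with rfl | rfl <;> push_cast <;> nlinarith

/-- If the `n`-th derivative stays above `ε`, then the lower derivatives grow at least like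
`ε * t ^ j / j!`. -/
theorem box_growth (o : ODE L.sig) (R : Dom L.sig) (c : Fin o.dim) (y : Fin o.dim → ℕ) (ε n : ℕ)
    (p : ℕ → DFTm L.sig) (hp : ∀ i < n, ∀ w : DFTm L.sig → ℝ, IsAlg w →
      w (L.lie o (p i)) = w (p (i + 1)))
    (hc : ∀ w : DFTm L.sig → ℝ, IsAlg w → w (o.rhs c) = 1)
    (hy : ∀ i, o.Fresh (y i)) (hε : ∀ i, o.vars i ≠ ε)
    (hz : ∀ x, (x = ε ∨ (∃ j, x = y j) ∨ ∃ i ≤ n, x ∈ (p i).atoms) →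
      Derivable L k Γ (.eq (Var.prime x).toTerm (.const 0)))
    (heq : Derivable L k Γ (o.vecEq y))
    (h0 : ∀ i < n, Derivable L k Γ (.eqZero (p i)))
    (hR : ∀ M B, IsAlg M → R.toFml.Sat M B → 0 < M (DFTm.toTerm (.sub (p n) (.atom ε))))
    (j : ℕ) (hj : j ≤ n) :
    Derivable L k Γ (.box (.ode o R) (.cmpZero .ge (.sub (p (n - j))
      (.mul (.const (1 / j.factorial)) (.mul (.atom ε) (Tm.pow (o.elapsed c y) j)))))) := by
  induction j with
  | zero =>
    refine box_entail [_] (by simpa only [List.forall_mem_singleton] using DW o R)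
      fun M B hM h => ?_
    have := hR M B hM (h _ List.mem_cons_self)
    simp only [hM.toTerm.sub] at this
    simp only [Fml.sat_geZero hM, hM.toTerm.sub, hM.toTerm.mul, hM.toTerm.const, hM.toTerm.pow]
    simpa using this.le
  | succ j ih =>
    -- Differentiating the claim for `j + 1` gives the claim for `j`, since `(t^(j+1) / (j+1)!)' =
    -- t^j / j!`. Initially both of its terms vanish.
    refine dI_ge _ _ _ (fun x hx => hz x ?_) ?_ (box_entail [_] (by
      simpa only [List.forall_mem_singleton] using ih (by omega)) fun M B hM h => ?_)
    · obtain ⟨hx, hx'⟩ := hx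
      simp only [Tm.atoms, Tm.atoms_sub, Set.mem_union, Set.mem_singleton_iff,
        Set.mem_empty_iff_false, false_or] at hx
      rcases hx with h | h | h
      · exact Or.inr (Or.inr ⟨_, by omega, h⟩)
      · exact Or.inl h
      · have h' := Tm.atoms_pow _ _ h
        simp only [ODE.elapsed, Tm.atoms_sub, Tm.atoms, Set.mem_union,
          Set.mem_singleton_iff] at h'
        rcases h' with h' | h'
        · exact absurd h'.symm (hx' c)
        · exact Or.inr (Or.inl ⟨c, h'⟩)
    · refine entail [_, _] (by
        simp only [List.forall_mem_cons]
        exact ⟨heq, h0 (n - (j + 1)) (by omega), by simp⟩) fun M B hM h => ?_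
      simp only [List.forall_mem_cons, sat_vecEq, Fml.sat_eqZero hM] at h
      simp only [Fml.sat_imp, Fml.sat_geZero hM, hM.toTerm.sub, hM.toTerm.mul, hM.toTerm.pow,
        ODE.elapsed, h.1, h.2.1]
      simp
    · simp only [List.forall_mem_singleton, Fml.sat_geZero hM, hM.toTerm.sub, hM.toTerm.mul,
        hM.toTerm.pow, hM.toTerm.const] at h
      simp only [Fml.sat_geZero hM, lie_sub hM.toTerm, lie_mul hM.toTerm, lie_const hM.toTerm,
        lie_param hM.toTerm o hε, lie_pow hM.toTerm,
        lie_elapsed hM.toTerm (hc _ hM.toTerm) hy, hM.toTerm.const, hM.toTerm.pow]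
      have e1 := hp (n - (j + 1)) (by omega) _ hM.toTerm
      rw [show n - (j + 1) + 1 = n - j by omega] at e1
      rw [e1]
      refine h.trans_eq ?_
      rw [Nat.factorial_succ]
      push_cast
      have := Nat.cast_ne_zero (R := ℝ) |>.2 j.factorial_ne_zero
      have : (j : ℝ) + 1 ≠ 0 := by positivity
      field_simp
      ring

/-- Along a system with a clock, a function that vanishes identically has no positive first
nonvanishing derivative. -/
theorem fls_of_pos (o : ODE L.sig) (Q : Dom L.sig) (hQ : Q.Strict) (c : Fin o.dim)
    (hc : ∀ w : DFTm L.sig → ℝ, IsAlg w → w (o.rhs c) = 1) (n m : ℕ) (p : ℕ → DFTm L.sig)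
    (hp : ∀ i < n, ∀ w : DFTm L.sig → ℝ, IsAlg w → w (L.lie o (p i)) = w (p (i + 1)))
    (ho : o.Below m) (hQm : ∀ x ∈ Q.vars, x < m) (hpm : ∀ i ≤ n, ∀ x ∈ (p i).atoms, x < m) :
    Derivable L .extended [.cmpZero .gt (p n), .bigAnd n (fun i => .eqZero (p i)), Q.toFml,
      .box (.ode o Q) (.eqZero (p 0))] .fls := by
  set Γ₀ : List (Fml L.sig) := [.cmpZero .gt (p n), .bigAnd n (fun i => .eqZero (p i)), Q.toFml,
      .box (.ode o Q) (.eqZero (p 0))] with hΓ₀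
  let F : DFTm L.sig := .add (.const 1) (.sum o.dim fun i => .mul (o.rhs i) (o.rhs i))
  let u : DFTm L.sig := .sub (p n) (.atom m)
  let v : DFTm L.sig := .sub (.const 1) (.mul (.atom m) F)
  have hF : ∀ x ∈ F.atoms, x < m := by
    intro x hx
    simp only [F, Tm.atoms, Tm.atoms_sum, Set.mem_union, Set.mem_iUnion, Set.mem_empty_iff_false,
      false_or, or_self] at hx
    obtain ⟨i, hi⟩ := hx
    exact ho.2 i x hi
  have hΓ₀m : ∀ χ ∈ Γ₀, χ.Below m := by
    simp only [hΓ₀, List.forall_mem_cons]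
    exact ⟨Fml.below_cmpZero _ (hpm n le_rfl),
      Fml.below_bigAnd fun i => Fml.below_cmpZero _ (hpm i i.2.le), Fml.below_toFml hQm,
      Fml.below_box ho hQm (Fml.below_cmpZero _ (hpm 0 (Nat.zero_le n))), by simp⟩
  -- a small constant `ε`
  refine of_ex (mp (ex_small m (p n) F (fun h => (hpm n le_rfl m h).false)
    (fun h => (hF m h).false)) (ax (by simp [hΓ₀]))) (fun χ hχ => (hΓ₀m χ hχ).base_notMem le_rfl)
    ((Fml.below_fls m).base_notMem le_rfl) ?_
  set ψ : Fml L.sig := .and (.cmpZero .gt (.atom m)) (.and (.cmpZero .gt u) (.cmpZero .gt v))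
    with hψ
  have hum : ∀ x ∈ u.atoms, x < m + 1 := by
    intro x hx
    simp only [u, Tm.atoms_sub, Tm.atoms, Set.mem_union, Set.mem_singleton_iff] at hx
    rcases hx with hx | hx
    · exact (hpm n le_rfl x hx).trans (Nat.lt_succ_self m)
    · omega
  have hvm : ∀ x ∈ v.atoms, x < m + 1 := by
    intro x hx
    simp only [v, Tm.atoms_sub, Tm.atoms, Set.mem_union, Set.mem_singleton_iff,
      Set.mem_empty_iff_false, false_or] at hx
    rcases hx with hx | hx
    · omega
    · exact (hF x hx).trans (Nat.lt_succ_self m)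
  have hΓ₁ : ∀ χ ∈ ψ :: Γ₀, χ.Below (m + 1) := by
    simp only [List.forall_mem_cons]
    exact ⟨(Fml.below_cmpZero _ (by simp [Tm.atoms])).and
      ((Fml.below_cmpZero _ hum).and (Fml.below_cmpZero _ hvm)),
      fun χ hχ => (hΓ₀m χ hχ).mono (Nat.le_succ m)⟩
  -- copies of the initial values
  let y : Fin o.dim → ℕ := fun i => m + 1 + i
  have hvars : ∀ i, o.vars i < m + 1 := fun i => (ho.1 i).trans (Nat.lt_succ_self m)
  refine of_vecEq o.vars (m + 1) hvars hΓ₁ (Fml.below_fls _) ?_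
  change Derivable L .extended (o.vecEq y :: ψ :: Γ₀) .fls
  -- constants have differential zero
  let K := m + 1 + o.dim
  refine of_prime_zero K ?_ (Fml.below_fls 0).prime_notMem ?_
  · rintro χ (_ | ⟨_, hχ⟩)
    · refine (Fml.below_bigAnd fun i => ?_ : (o.vecEq y).Below K).prime_notMem
      have := hvars i
      have := i.2
      refine Set.union_subset ?_ ?_
      · rw [Term.fv_var, Set.singleton_subset_iff]
        exact ⟨_, by simp only [Set.mem_Iio, K]; omega, rfl⟩
      · rw [Term.fv_var, Set.singleton_subset_iff]
        exact ⟨_, by simp only [Set.mem_Iio, K, y]; omega, rfl⟩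
    · exact (hΓ₁ χ hχ).prime_notMem
  set Γ := (List.range K).map (fun x => (.eq (Var.prime x).toTerm (.const 0) : Fml L.sig)) ++
    (o.vecEq y :: ψ :: Γ₀) with hΓ
  have hz : ∀ x < K, Derivable L .extended Γ (.eq (Var.prime x).toTerm (.const 0)) :=
    fun x hx => ax (List.mem_append_left _ (List.mem_map.2 ⟨x, List.mem_range.2 hx, rfl⟩))
  have heq : Derivable L .extended Γ (o.vecEq y) := ax (by simp [hΓ])
  have hsmall : Derivable L .extended Γ ψ := ax (by simp [hΓ])
  have hpos : Derivable L .extended Γ (.cmpZero .gt (.atom m)) :=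
    entail [_] (by simpa only [List.forall_mem_singleton] using hsmall)
      fun M B hM h => (h ψ List.mem_cons_self).1
  have hin : ∀ χ ∈ Γ₀, Derivable L .extended Γ χ := fun χ hχ => ax (by simp [hΓ, hχ])
  have hfy : ∀ i, o.Fresh (y i) := fun i => ho.fresh (by simp only [y]; omega)
  have hzm : ∀ x, (x = m ∨ ∃ j, x = y j) →
      Derivable L .extended Γ (.eq (Var.prime x).toTerm (.const 0)) := by
    rintro x (rfl | ⟨j, rfl⟩)
    · exact hz _ (by simp only [K]; omega)
    · exact hz _ (by simp only [K, y]; omega)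
  -- `u > 0` keeps `p n` above `ε`, and `v > 0` bounds the speed. Both are strict, so `R` is still a
  -- domain in which the flow can start to move.
  let R : Dom L.sig := .and Q (.and (.cmp .gt u (.const 0)) (.cmp .gt v (.const 0)))
  have hRu : ∀ M B, IsAlg M → R.toFml.Sat M B → 0 < M u.toTerm := fun M B hM h =>
    (Fml.sat_gtZero hM).1 h.2.1
  have hRv : ∀ M B, IsAlg M → R.toFml.Sat M B → 0 < M v.toTerm := fun M B hM h =>
    (Fml.sat_gtZero hM).1 h.2.2
  -- The clock has right-hand side 1.
  have hfix : Derivable L .extended [] (.not (.bigAnd o.dim (fun i => .eqZero (o.rhs i)))) := by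
    refine entail_nil fun M B hM h => ?_
    have h1 := (Fml.sat_eqZero hM).1 ((Fml.sat_bigAnd _ _).1 h c)
    have h2 := hc _ hM.toTerm
    rw [h1] at h2
    exact zero_ne_one h2
  have hdia : Derivable L .extended Γ (.dia (.ode o R) (.not (o.vecEq y))) := by
    refine mp (dia_strict o y hfix ?_ hfy (hQ.and ((Dom.Strict.gt u _).and (Dom.Strict.gt v _)))
      ?_ heq) ?_
    · intro i j hij
      have hij : m + 1 + (i : ℕ) = m + 1 + j := hij
      exact Fin.ext (by omega)
    · intro i hi
      replace hi : y i ∈ Q.vars ∪ ((u.atoms ∪ ∅) ∪ (v.atoms ∪ ∅)) := hi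
      simp only [Set.union_empty, Set.mem_union] at hi
      have : y i < m + 1 := by
        rcases hi with hi | hi | hi
        · exact (hQm _ hi).trans (Nat.lt_succ_self m)
        · exact hum _ hi
        · exact hvm _ hi
      simp only [y] at this
      omega
    · exact andR (hin _ (by simp [hΓ₀])) (entail [_] (by
        simpa only [List.forall_mem_singleton] using hsmall)
        fun M B hM h => (h ψ List.mem_cons_self).2)
  have hbox0 : Derivable L .extended Γ (.box (.ode o R) (.eqZero (p 0))) :=
    mp (box_dom_mono o fun M B _ h => h.1) (hin _ (by simp [hΓ₀]))
  have hgrow := box_growth o R c y m n p hp hc hfy (fun i => (ho.1 i).ne) (by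
      rintro x (h | h | ⟨i, hi, h⟩)
      · exact hzm x (Or.inl h)
      · exact hzm x (Or.inr h)
      · have := hpm i hi x h
        exact hz x (by simp only [K]; omega)) heq (fun i hi => entail [_] (by
          simpa only [List.forall_mem_singleton] using
            hin (.bigAnd n (fun i => .eqZero (p i))) (by simp [hΓ₀]))
        fun M B hM h => (Fml.sat_bigAnd _ _).1 (h _ List.mem_cons_self) ⟨i, hi⟩) hRu n le_rfl
  rw [Nat.sub_self] at hgrow
  have hposb : Derivable L .extended Γ (.box (.ode o R) (.cmpZero .gt (.atom m))) := by
    refine box_const ?_ hpos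
    simpa [Fml.fv_cmpZero, Tm.atoms, Prog.bound, ODE.bound, eq_comm] using
      fun i => (ho.1 i).ne
  have hspeed := fun i s hs => box_speed o R c i y m s hs hc hfy (fun i => (ho.1 i).ne) hzm heq
    hpos hRv
  have htime : Derivable L .extended Γ (.box (.ode o R) (.cmpZero .ge (o.elapsed c y))) := by
    refine dI_ge _ _ _ (fun x hx => hzm x ?_) (entail [_] (by
      simpa only [List.forall_mem_singleton] using heq) fun M B hM h => ?_)
      (box_entail [] (by simp) fun M B hM _ => ?_)
    · obtain ⟨hx, hx'⟩ := hx
      simp only [ODE.elapsed, Tm.atoms_sub, Tm.atoms, Set.mem_union, Set.mem_singleton_iff] at hx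
      rcases hx with h | h
      · exact absurd h.symm (hx' c)
      · exact Or.inr ⟨c, h⟩
    · simp only [List.forall_mem_singleton, sat_vecEq] at h
      simp [Fml.sat_imp, Fml.sat_geZero hM, ODE.elapsed, hM.toTerm.sub, h]
    · rw [Fml.sat_geZero hM, lie_elapsed hM.toTerm (hc _ hM.toTerm) hfy]
      exact zero_le_one
  -- Cont only says that some coordinate differs from its initial value, so a stopped clock has to
  -- be shown to stop every coordinate.
  have hstill : Derivable L .extended Γ (.box (.ode o R) (o.vecEq y)) := by
    refine box_entail ((List.finRange o.dim).map fun i =>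
      .eq (Var.base (o.vars i)).toTerm (Var.base (y i)).toTerm) ?_ fun M B hM h => ?_
    · intro χ hχ
      obtain ⟨i, -, rfl⟩ := List.mem_map.1 hχ
      refine box_entail [_, _, _, _, _, _] (by
        simp only [List.forall_mem_cons]
        exact ⟨hbox0, hgrow, hposb, htime, hspeed i 1 (Or.inl rfl), hspeed i (-1) (Or.inr rfl),
          by simp⟩) fun M B hM h => ?_
      simp only [List.forall_mem_cons, Fml.sat_eqZero hM, Fml.sat_geZero hM, Fml.sat_gtZero hM,
        hM.toTerm.sub, hM.toTerm.add, hM.toTerm.mul, hM.toTerm.const, hM.toTerm.pow] at h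
      obtain ⟨h1, h2, h3, h4, h5, h6, -⟩ := h
      change M (DFTm.toTerm (.atom (o.vars i))) = M (DFTm.toTerm (.atom (y i)))
      set τ := M (o.elapsed c y).toTerm
      set E := M (DFTm.toTerm (.atom m))
      rw [h1] at h2
      -- Growth reads `0 ≥ ε τ^n / n!` because `p 0 = 0` along the flow; this excludes `τ > 0`, also
      -- for `n = 0`.
      have hτ : τ = 0 := by
        rcases h4.eq_or_lt with h4 | h4
        · exact h4.symm
        · exfalso
          have : 0 < (((1 / (n.factorial : ℚ) : ℚ)) : ℝ) * (E * τ ^ n) := by positivity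
          linarith
      rw [hτ] at h5 h6
      push_cast at h5 h6
      have h7 : E * (M (DFTm.toTerm (.atom (o.vars i))) - M (DFTm.toTerm (.atom (y i)))) = 0 := by
        linarith
      rcases mul_eq_zero.1 h7 with h7 | h7
      · exact absurd h7 h3.ne'
      · linarith
    · refine (Fml.sat_bigAnd _ _).2 fun i => h _ ?_
      exact List.mem_map.2 ⟨i, List.mem_finRange i, rfl⟩
  refine entail [_, _, _] (by
    simp only [List.forall_mem_cons]
    exact ⟨hdia, diamond (.ode o R) (.not (o.vecEq y)),
      box_entail (φ := .not (.not (o.vecEq y))) [_] (by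
        simpa only [List.forall_mem_singleton] using hstill)
        (fun M B hM h => not_not.2 (h _ List.mem_cons_self)), by simp⟩) fun M B hM h => ?_
  simp only [List.forall_mem_cons, Fml.sat_iff, Fml.Sat] at h
  tauto

/-- The rank `N` is arbitrary here: a function that vanishes along the flow has vanishing
derivatives of every order, and no radical identity is involved. -/
theorem diffRadical_of_box (o : ODE L.sig) (e : DFTm L.sig) (N : ℕ) (Q : Dom L.sig)
    (hQ : Q.Strict) : Derivable L .extended [] (.imp (.box (.ode o Q) (.eqZero e))
      (.imp Q.toFml (L.diffRadicalFml o e N))) := by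
  let p := L.lieN o e
  obtain ⟨m, ho, hQm, hpm⟩ := exists_bound o Q N p
  have hm : ∀ i ≤ N, m ∉ (p i).atoms := fun i hi h => (hpm i hi m h).false
  have hfr : o.Fresh m := ho.fresh le_rfl
  -- The clock equation in the form `a y + b` that DG prescribes; it equals 1 only up to algebra,
  -- which is why `hc` quantifies over valuations.
  let t : DFTm L.sig := .add (.mul (.const 0) (.atom m)) (.const 1)
  let o' := o.extend m hfr t
  have ho' : o'.Below (m + 1) := ho.extend hfr (by simp [t, Tm.atoms])
  have hc : ∀ w : DFTm L.sig → ℝ, IsAlg w → w (o'.rhs (Fin.last o.dim)) = 1 := fun w hw => by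
    have : o'.rhs (Fin.last o.dim) = t := by simp [o', ODE.extend]
    simp [this, t, hw.add, hw.mul, hw.const]
  have hlie : ∀ i ≤ N, ∀ w : DFTm L.sig → ℝ, IsAlg w → w (L.lie o' (p i)) = w (p (i + 1)) :=
    fun i hi w hw => lie_extend hw o hfr t (p i) (hm i hi)
  have hφ : ∀ n ≤ N, (L.diffRadicalFml o e n).Below m := fun n hn =>
    Fml.below_bigAnd fun i => Fml.below_cmpZero _ (hpm i (i.2.le.trans hn))
  have he : (Fml.eqZero e).Below m := Fml.below_cmpZero _ (hpm 0 (Nat.zero_le N))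
  refine impR (impR ?_)
  refine of_ex (iff_mp (DG o Q (.eqZero e) m (.const 0) (.const 1) hfr
    (fun h => (hQm m h).false) (by simp [Tm.atoms]) (by simp [Tm.atoms])
    (he.base_notMem le_rfl) (he.prime_notMem m)) (ax (by simp))) ?_
    ((hφ N le_rfl).base_notMem le_rfl) ?_
  · simp only [List.forall_mem_cons]
    exact ⟨(Fml.below_toFml hQm).base_notMem le_rfl,
      (Fml.below_box ho hQm he).base_notMem le_rfl, by simp⟩
  -- The initial clock value given by DG is arbitrary; only differences of clock values matter.
  suffices h : ∀ n ≤ N, Derivable L .extended [Q.toFml, .box (.ode o' Q) (.eqZero e)]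
      (L.diffRadicalFml o e n) from weaken (by simp [o', t]) (h N le_rfl)
  intro n hn
  induction n with
  | zero => exact entail_nil fun M B _ => show Fml.Sat M B .tru from rfl
  | succ n ih =>
    have ih := ih (by omega)
    refine andR ih ?_
    have hlt : ∀ i ≤ n, ∀ x ∈ (p i).atoms, x < m + 1 := fun i hi x hx =>
      (hpm i (by omega) x hx).trans (Nat.lt_succ_self m)
    have hQm' : ∀ x ∈ Q.vars, x < m + 1 := fun x hx => (hQm x hx).trans (Nat.lt_succ_self m)
    have h₁ := fls_of_pos o' Q hQ (Fin.last o.dim) hc n (m + 1) p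
      (fun i hi => hlie i (by omega)) ho' hQm' hlt
    -- The negated chain excludes `p n < 0`. `fls_of_pos` accepts any chain that is successively
    -- differentiated up to algebra, so the terms need not be iterated Lie derivatives literally.
    have h₂ := fls_of_pos o' Q hQ (Fin.last o.dim) hc n (m + 1) (fun i => (p i).neg)
      (fun i hi w hw => by rw [lie_neg hw, hlie i (by omega) w hw, hw.neg]) ho' hQm'
      (fun i hi => by simpa [Tm.neg, Tm.atoms] using hlt i hi)
    have hQ0 : Derivable L .extended [Q.toFml, .box (.ode o' Q) (.eqZero e)] Q.toFml :=
      ax (by simp)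
    have hb : Derivable L .extended [Q.toFml, .box (.ode o' Q) (.eqZero e)]
      (.box (.ode o' Q) (.eqZero (p 0))) := ax (by simp [p, TermLang.lieN])
    have hb' : Derivable L .extended [Q.toFml, .box (.ode o' Q) (.eqZero e)]
      (.box (.ode o' Q) (.eqZero (p 0).neg)) :=
      box_entail [_] (by simpa only [List.forall_mem_singleton] using hb) fun M B hM h => by
        simpa [Fml.sat_eqZero hM, hM.toTerm.neg] using h
    have ih' : Derivable L .extended [Q.toFml, .box (.ode o' Q) (.eqZero e)]
        (.bigAnd n fun i => .eqZero (p i).neg) :=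
      entail [_] (by simpa only [List.forall_mem_singleton] using ih) fun M B hM h => by
        refine (Fml.sat_bigAnd _ _).2 fun i => ?_
        have := (Fml.sat_eqZero hM).1 ((Fml.sat_bigAnd _ _).1 (h _ List.mem_cons_self) i)
        rw [Fml.sat_eqZero hM, hM.toTerm.neg]
        simpa using this
    have weak := fun ψ => List.subset_cons_self ψ [Q.toFml, .box (.ode o' Q) (.eqZero e)]
    have n₁ := notR (φ := .cmpZero .gt (p n)) (of_premises h₁ (by
      simp only [List.forall_mem_cons]
      exact ⟨ax (by simp), weaken (weak _) ih, weaken (weak _) hQ0, weaken (weak _) hb, by simp⟩))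
    have n₂ := notR (φ := .cmpZero .gt (p n).neg) (of_premises h₂ (by
      simp only [List.forall_mem_cons]
      exact ⟨ax (by simp), weaken (weak _) ih', weaken (weak _) hQ0, weaken (weak _) hb', by simp⟩))
    refine entail [_, _] (by
      simp only [List.forall_mem_cons]
      exact ⟨n₁, n₂, by simp⟩) fun M B hM h => ?_
    simp only [List.forall_mem_cons, Fml.Sat, Fml.sat_gtZero hM, hM.toTerm.neg] at h
    refine (Fml.sat_eqZero hM).2 (le_antisymm (not_lt.1 h.1) ?_)
    exact neg_nonpos.1 (not_lt.1 h.2.1)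

end Derivable

end DL

theorem mainTheorem1 (L : DL.TermLang) (hL : L.ExtendedTermConditions)
    (o : DL.ODE L.sig) (e : DL.DFTm L.sig) (N : ℕ) (g : Fin N → DL.DFTm L.sig)
    (hN : L.DiffRadical o e N g) :
    (∀ Q : DL.Dom L.sig, DL.Derivable L .base []
      (.imp (.imp Q.toFml (L.diffRadicalFml o e N)) (.box (.ode o Q) (.eqZero e)))) ∧
    (∀ Q : DL.Dom L.sig, Q.Strict → DL.Derivable L .extended []
      (.iff (.box (.ode o Q) (.eqZero e)) (.imp Q.toFml (L.diffRadicalFml o e N)))) :=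
  ⟨fun Q => DL.Derivable.box_of_diffRadical hN Q, fun Q hQ => .andR
    (DL.Derivable.diffRadical_of_box o e N Q hQ) (DL.Derivable.box_of_diffRadical hN Q)⟩
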